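/- Let $r\ge 4$ and let $T_1^1,\dots,T_1^r:\mathbb{C}\to\mathbb{C}$ be arbitrary functions. For fixed $u\in\mathbb{C}$ and $l\in\mathbb{Z}$ put $x_l^a=T_1^a(u+l)$ for $1\le a\le r$ and $x_l^0=1$. Define infinite matrices $\mathcal{T}=(\mathcal{T}_{ij})_{i,j\in\mathbb{Z}}$ and $\mathcal{E}=(\mathcal{E}_{ij})_{i,j\in\mathbb{Z}}$ by $$\mathcal{T}_{ij}=\begin{cases} x_{\frac{i+j}{2}-1}^{\frac{j-i}{2}+1} & i \text{ odd},\ \frac{i-j}{2}\in\{1,0,\ldots,3-r\},\\ -x_{\frac{i+j-1}{2}}^{r-1} & i\text{ odd},\ \frac{i-j}{2}=\frac52-r,\\ -x_{\frac{i+j-3}{2}}^{r} & i\text{ odd},\ \frac{i-j}{2}=\frac32-r,\\ -x_{\frac{i+j}{2}-1}^{\frac{i-j}{2}+2r-3} & i\text{ odd},\ \frac{i-j}{2}\in\{1-r,-r,\ldots,3-2r\},\\ 0&\text{otherwise},\end{cases} \qquad \mathcal{E}_{ij}=\begin{cases} 1 & i\text{ even},\ j=i,\\ -1 & i\text{ even},\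 j=i+4,\\ x_i^{r-1} & i\text{ even},\ j=i+3,\\ x_{i-2}^{r} & i\text{ even},\ j=i+1,\\ 0&\text{otherwise}.\end{cases}$$ For an entry $\pm x_l^a$, let $\mathcal{T}_n(i,j,\pm x_l^a)$ denote the $n\times n$ block of consecutive rows and columns of $\mathcal{T}$, after a suitable overall shift $x_m^b\mapsto x_{m+\xi}^b$ of all lower indices, whose $(i,j)$ entry is the entry $\pm x_l^a$ of the shifted matrix (if $(i,j)$ lies outside the block, it is located relative to the block in the infinite matrix). Moving two steps down the diagonal is the same as shifting all lower indices by $2$, so this block is well defined. Define $\mathcal{E}_n(i,j,x_l^a)$ in the same way. Set $T_0^a(u)=1$ for $1\le a\le r$, $T_k^0(u)=1$ for $k\ge0$, and for $k\ge1$ set $$T_k^a(u)=\det\bigl(\mathcal{T}_{2k-1}(1,1,x_{-k+1}^a)+\mathcal{E}_{2k-1}(2,3,x^r_{-k-r+a+4})\bigr)\qquad(1\le a\le r-2),$$ $$T_k^{r-1}(u)=\mathrm{pf}\bigl(\mathcal{T}_{2k}(2,1,-x_{-k+1}^{r-1})+\mathcal{E}_{2k}(1,2,x_{-k+1}^{r-1})\bigr),$$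 $$T_k^{r}(u)=(-1)^k\,\mathrm{pf}\bigl(\mathcal{T}_{2k}(1,2,-x_{-k+1}^{r})+\mathcal{E}_{2k}(2,1,x_{-k+1}^{r})\bigr).$$ Then the matrices under the Pfaffians are skew-symmetric, for $k=1$ these formulas return the given functions $T_1^a$, and for all $k\ge1$ and $u\in\mathbb{C}$ the $D_r$ discrete Toda equations hold: $$T_k^a(u-1)T_k^a(u+1)-T_{k+1}^a(u)T_{k-1}^a(u)=\begin{cases} T_k^{a-1}(u)T_k^{a+1}(u)&1\le a\le r-3,\\ T_k^{r-3}(u)T_k^{r-1}(u)T_k^r(u)&a=r-2,\\ T_k^{r-2}(u)&a=r-1,\,r.\end{cases}$$ -/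

import Mathlib

open Matrix

/-- The discrete Toda equations (T-system) of type `D_r` for complex numbers `T k a u`
(`k` is the lower index, `a` the upper index, `u` the argument), together with the conventions
`T_0^a = 1` for `1 ≤ a ≤ r` and `T_k^0 = 1`. -/
structure IsTodaSolution (r : ℕ) (T : ℕ → ℕ → ℂ → ℂ) : Prop where
  k_zero : ∀ a, 1 ≤ a → a ≤ r → ∀ u, T 0 a u = 1
  a_zero : ∀ k u, T k 0 u = 1
  eq_lt : ∀ k, 1 ≤ k → ∀ a, 1 ≤ a → a ≤ r - 3 → ∀ u,
    T k a (u - 1) * T k a (u + 1) - T (k + 1) a u * T (k - 1) a u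
      = T k (a - 1) u * T k (a + 1) u
  eq_fork : ∀ k, 1 ≤ k → ∀ u,
    T k (r - 2) (u - 1) * T k (r - 2) (u + 1) - T (k + 1) (r - 2) u * T (k - 1) (r - 2) u
      = T k (r - 3) u * T k (r - 1) u * T k r u
  eq_spinor : ∀ k, 1 ≤ k → ∀ a, (a = r - 1 ∨ a = r) → ∀ u,
    T k a (u - 1) * T k a (u + 1) - T (k + 1) a u * T (k - 1) a u = T k (r - 2) u

/-- The Pfaffian of a skew-symmetric `2n × 2n` matrix:
`(1 / (2^n n!)) ∑_σ sgn σ ∏_{i < n} A (σ (2i)) (σ (2i+1))` (indices from `0`). -/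
noncomputable def pfaffian {n : ℕ} (A : Matrix (Fin (2 * n)) (Fin (2 * n)) ℂ) : ℂ :=
  (1 / ((2 : ℂ) ^ n * (n.factorial : ℂ))) *
    ∑ σ : Equiv.Perm (Fin (2 * n)), ((Equiv.Perm.sign σ : ℤ) : ℂ) *
      ∏ i : Fin n, A (σ ⟨2 * i.1, by omega⟩) (σ ⟨2 * i.1 + 1, by omega⟩)

/-- The quantities `x_l^a = T_1^a(u + l)` for `a ≥ 1`, and `x_l^0 = 1`; here `t a = T_1^a`. -/
def xvar (t : ℕ → ℂ → ℂ) (u : ℂ) (a : ℕ) (l : ℤ) : ℂ :=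
  if a = 0 then 1 else t a (u + (l : ℂ))

/-- The overall shift `u → u + ξ` of lower indices. -/
def shiftVar (ξ : ℤ) (x : ℕ → ℤ → ℂ) : ℕ → ℤ → ℂ := fun a l => x a (l + ξ)

/-- The infinite matrix `𝒯`, with rows and columns indexed by `ℤ`.  All divisions by `2` below
are exact. -/
def calT (r : ℕ) (x : ℕ → ℤ → ℂ) : Matrix ℤ ℤ ℂ := Matrix.of fun i j =>
  if Odd i ∧ Even (i - j) ∧ 3 - (r : ℤ) ≤ (i - j) / 2 ∧ (i - j) / 2 ≤ 1 then
    x ((j - i) / 2 + 1).toNat ((i + j) / 2 - 1)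
  else if Odd i ∧ i - j = 5 - 2 * (r : ℤ) then
    -x (r - 1) ((i + j - 1) / 2)
  else if Odd i ∧ i - j = 3 - 2 * (r : ℤ) then
    -x r ((i + j - 3) / 2)
  else if Odd i ∧ Even (i - j) ∧ 3 - 2 * (r : ℤ) ≤ (i - j) / 2 ∧ (i - j) / 2 ≤ 1 - (r : ℤ) then
    -x ((i - j) / 2 + 2 * (r : ℤ) - 3).toNat ((i + j) / 2 - 1)
  else 0

/-- The infinite matrix `ℰ`, with rows and columns indexed by `ℤ`. -/
def calE (r : ℕ) (x : ℕ → ℤ → ℂ) : Matrix ℤ ℤ ℂ := Matrix.of fun i j =>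
  if Even i ∧ i = j then 1
  else if Even i ∧ i = j - 4 then -1
  else if Even i ∧ i = j - 3 then x (r - 1) i
  else if Even i ∧ i = j - 1 then x r (i - 2)
  else 0

/-- The `n × n` block of consecutive rows and columns of an infinite matrix whose entry in place
`(i, j)` (counted from `1`) is the entry of the infinite matrix in place `(s, t)`. -/
def block (M : Matrix ℤ ℤ ℂ) (n : ℕ) (i j s t : ℤ) : Matrix (Fin n) (Fin n) ℂ :=
  Matrix.of fun p q => M (s + ((p : ℤ) + 1 - i)) (t + ((q : ℤ) + 1 - j))

/-- `𝒯_n(i, j, x_l^a)`, `1 ≤ a ≤ r - 2`: the `n × n` block of a shift of `𝒯` whose `(i, j)` entry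
is `x_l^a`. -/
def subT (r : ℕ) (x : ℕ → ℤ → ℂ) (n : ℕ) (i j : ℤ) (a : ℕ) (l : ℤ) : Matrix (Fin n) (Fin n) ℂ :=
  block (calT r (shiftVar (l - ((a : ℤ) - 1)) x)) n i j 1 (2 * (a : ℤ) - 1)

/-- `𝒯_n(i, j, -x_l^{r-1})`: the `n × n` block of a shift of `𝒯` whose `(i, j)` entry is
`-x_l^{r-1}`. -/
def subTPred (r : ℕ) (x : ℕ → ℤ → ℂ) (n : ℕ) (i j : ℤ) (l : ℤ) : Matrix (Fin n) (Fin n) ℂ :=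
  block (calT r (shiftVar (l - ((r : ℤ) - 2)) x)) n i j 1 (2 * (r : ℤ) - 4)

/-- `𝒯_n(i, j, -x_l^r)`: the `n × n` block of a shift of `𝒯` whose `(i, j)` entry is `-x_l^r`. -/
def subTLast (r : ℕ) (x : ℕ → ℤ → ℂ) (n : ℕ) (i j : ℤ) (l : ℤ) : Matrix (Fin n) (Fin n) ℂ :=
  block (calT r (shiftVar (l - ((r : ℤ) - 2)) x)) n i j 1 (2 * (r : ℤ) - 2)

/-- `ℰ_n(i, j, x_l^{r-1})`: the `n × n` block of a shift of `ℰ` whose `(i, j)` entry is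
`x_l^{r-1}`. -/
def subEPred (r : ℕ) (x : ℕ → ℤ → ℂ) (n : ℕ) (i j : ℤ) (l : ℤ) : Matrix (Fin n) (Fin n) ℂ :=
  block (calE r (shiftVar l x)) n i j 0 3

/-- `ℰ_n(i, j, x_l^r)`: the `n × n` block of a shift of `ℰ` whose `(i, j)` entry is `x_l^r`. -/
def subELast (r : ℕ) (x : ℕ → ℤ → ℂ) (n : ℕ) (i j : ℤ) (l : ℤ) : Matrix (Fin n) (Fin n) ℂ :=
  block (calE r (shiftVar (l + 2) x)) n i j 0 1

/-- The block `𝒯_{2k-1}(1, 1, x_{-k+1}^a) + ℰ_{2k-1}(2, 3, x_{-k-r+a+4}^r)`. -/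
def vectorMatrix (r : ℕ) (x : ℕ → ℤ → ℂ) (k a : ℕ) :
    Matrix (Fin (2 * k - 1)) (Fin (2 * k - 1)) ℂ :=
  subT r x (2 * k - 1) 1 1 a (-(k : ℤ) + 1)
    + subELast r x (2 * k - 1) 2 3 (-(k : ℤ) - (r : ℤ) + (a : ℤ) + 4)

/-- The block `𝒯_{2k}(2, 1, -x_{-k+1}^{r-1}) + ℰ_{2k}(1, 2, x_{-k+1}^{r-1})`. -/
def spinorMatrixPred (r : ℕ) (x : ℕ → ℤ → ℂ) (k : ℕ) : Matrix (Fin (2 * k)) (Fin (2 * k)) ℂ :=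
  subTPred r x (2 * k) 2 1 (-(k : ℤ) + 1) + subEPred r x (2 * k) 1 2 (-(k : ℤ) + 1)

/-- The block `𝒯_{2k}(1, 2, -x_{-k+1}^r) + ℰ_{2k}(2, 1, x_{-k+1}^r)`. -/
def spinorMatrixLast (r : ℕ) (x : ℕ → ℤ → ℂ) (k : ℕ) : Matrix (Fin (2 * k)) (Fin (2 * k)) ℂ :=
  subTLast r x (2 * k) 1 2 (-(k : ℤ) + 1) + subELast r x (2 * k) 2 1 (-(k : ℤ) + 1)

/-- The determinant and Pfaffian expressions for `T_k^a(u)` in terms of `t a = T_1^a`, with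
`T_0^a = T_k^0 = 1`. -/
noncomputable def todaT (r : ℕ) (t : ℕ → ℂ → ℂ) (k a : ℕ) (u : ℂ) : ℂ :=
  if k = 0 ∨ a = 0 then 1
  else if a ≤ r - 2 then (vectorMatrix r (xvar t u) k a).det
  else if a = r - 1 then pfaffian (spinorMatrixPred r (xvar t u) k)
  else (-1) ^ k * pfaffian (spinorMatrixLast r (xvar t u) k)

/-- Moving two steps down the diagonal of `𝒯` shifts lower indices by `2`: so the blocks above do
not depend on which occurrence of the pivot entry, in which shift of `𝒯`, is chosen. -/
theorem calT_add_two (r : ℕ) (x : ℕ → ℤ → ℂ) (i j : ℤ) :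
    calT r x (i + 2) (j + 2) = calT r (shiftVar 2 x) i j := by
  have h1 : Odd (i + 2) ↔ Odd i := by simp
  have h2 : i + 2 - (j + 2) = i - j := by ring
  have h3 : j + 2 - (i + 2) = j - i := by ring
  have h4 : (i + 2 + (j + 2)) / 2 - 1 = (i + j) / 2 - 1 + 2 := by omega
  have h5 : (i + 2 + (j + 2) - 1) / 2 = (i + j - 1) / 2 + 2 := by omega
  have h6 : (i + 2 + (j + 2) - 3) / 2 = (i + j - 3) / 2 + 2 := by omega
  simp only [calT, Matrix.of_apply, shiftVar, h1, h2, h3, h4, h5, h6]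

theorem calE_add_two (r : ℕ) (x : ℕ → ℤ → ℂ) (i j : ℤ) :
    calE r x (i + 2) (j + 2) = calE r (shiftVar 2 x) i j := by
  have h1 : Even (i + 2) ↔ Even i := by simp
  have h2 : i + 2 = j + 2 ↔ i = j := by omega
  have h3 : i + 2 = j + 2 - 4 ↔ i = j - 4 := by omega
  have h4 : i + 2 = j + 2 - 3 ↔ i = j - 3 := by omega
  have h5 : i + 2 = j + 2 - 1 ↔ i = j - 1 := by omega
  have h6 : i + 2 - 2 = i - 2 + 2 := by ring
  simp only [calE, Matrix.of_apply, shiftVar, h1, h2, h3, h4, h5, h6]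

theorem subT_apply (r : ℕ) (x : ℕ → ℤ → ℂ) (n : ℕ) (p q : Fin n) (a : ℕ) (l : ℤ)
    (ha : 1 ≤ a) (har : a ≤ r - 2) :
    subT r x n ((p : ℤ) + 1) ((q : ℤ) + 1) a l p q = x a l := by
  have e : Even ((1 : ℤ) - (2 * (a : ℤ) - 1)) := ⟨1 - a, by ring⟩
  have h1 : ((1 : ℤ) - (2 * (a : ℤ) - 1)) / 2 = 1 - a := by omega
  have h2 : ((2 * (a : ℤ) - 1 - 1) / 2 + 1).toNat = a := by omega
  have h3 : ((1 : ℤ) + (2 * (a : ℤ) - 1)) / 2 - 1 + (l - ((a : ℤ) - 1)) = l := by omega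
  have h4 : (3 : ℤ) - r ≤ 1 - a := by omega
  have h5 : (1 : ℤ) - a ≤ 1 := by omega
  simp only [subT, block, calT, Matrix.of_apply, shiftVar, sub_self, add_zero]
  rw [if_pos ⟨odd_one, e, by rw [h1]; exact h4, by rw [h1]; exact h5⟩, h2, h3]

theorem subTPred_apply (r : ℕ) (x : ℕ → ℤ → ℂ) (n : ℕ) (p q : Fin n) (l : ℤ) :
    subTPred r x n ((p : ℤ) + 1) ((q : ℤ) + 1) l p q = -x (r - 1) l := by
  have e : ¬ Even ((1 : ℤ) - (2 * (r : ℤ) - 4)) := by rw [Int.even_iff]; omega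
  have h1 : (1 : ℤ) - (2 * (r : ℤ) - 4) = 5 - 2 * r := by ring
  have h3 : ((1 : ℤ) + (2 * (r : ℤ) - 4) - 1) / 2 + (l - ((r : ℤ) - 2)) = l := by omega
  simp only [subTPred, block, calT, Matrix.of_apply, shiftVar, sub_self, add_zero]
  rw [if_neg (fun h => e h.2.1), if_pos ⟨odd_one, h1⟩, h3]

theorem subTLast_apply (r : ℕ) (x : ℕ → ℤ → ℂ) (n : ℕ) (p q : Fin n) (l : ℤ) :
    subTLast r x n ((p : ℤ) + 1) ((q : ℤ) + 1) l p q = -x r l := by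
  have e : ¬ Even ((1 : ℤ) - (2 * (r : ℤ) - 2)) := by rw [Int.even_iff]; omega
  have h0 : (1 : ℤ) - (2 * (r : ℤ) - 2) ≠ 5 - 2 * r := by omega
  have h1 : (1 : ℤ) - (2 * (r : ℤ) - 2) = 3 - 2 * r := by ring
  have h3 : ((1 : ℤ) + (2 * (r : ℤ) - 2) - 3) / 2 + (l - ((r : ℤ) - 2)) = l := by omega
  simp only [subTLast, block, calT, Matrix.of_apply, shiftVar, sub_self, add_zero]
  rw [if_neg (fun h => e h.2.1), if_neg (fun h => h0 h.2), if_pos ⟨odd_one, h1⟩, h3]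

theorem subEPred_apply (r : ℕ) (x : ℕ → ℤ → ℂ) (n : ℕ) (p q : Fin n) (l : ℤ) :
    subEPred r x n ((p : ℤ) + 1) ((q : ℤ) + 1) l p q = x (r - 1) l := by
  simp [subEPred, block, calE, shiftVar]

theorem subELast_apply (r : ℕ) (x : ℕ → ℤ → ℂ) (n : ℕ) (p q : Fin n) (l : ℤ) :
    subELast r x n ((p : ℤ) + 1) ((q : ℤ) + 1) l p q = x r l := by
  simp [subELast, block, calE, shiftVar]

/-!
The matrices of the statement are blocks of infinite matrices. For `a ≤ r - 2` the matrix of `T_k^a`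
is a diagonal block of `vectorInf r x a`; for the spinor nodes `r - 1` and `r` it is a diagonal
block of the skew-symmetric matrix `spinorInf r x`. Moving a block two steps down the diagonal
shifts all lower indices by `2`, that is, changes `u` by `2`.

For `a ≤ r - 2` the Toda equation is Dodgson condensation (`window_desnanot_jacobi`) for the block
of size `2k + 1` of `T_{k+1}^a`. Its two connected minors of size `2k` are `T_k^a(u ± 1)` and its
central minor of size `2k - 1` is `T_{k-1}^a(u)`: they are larger than the matrices of these, but
the surplus rows and columns contain a single nonzero entry, equal to `1`. Exchanging neighbouring
rows in pairs turns the other two minors of size `2k` into `(-1)^k T_k^{a-1}(u)` and, for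
`a ≤ r - 3`, `(-1)^k T_k^{a+1}(u)`. For `a = r - 2` the latter is instead a block of `spinorInf` of
size `2k` just below the diagonal. Such a minor of a skew-symmetric matrix of odd size is the product
of two Pfaffians (`det_castSucc_succ_eq_pf_mul_pf`).

For the spinor nodes one needs a quadratic identity for the Pfaffians of a skew-symmetric matrix.
Let `W` be an odd set of indices, `c`, `d` two further indices and `a`, `b` two vectors; then
`det_consTwoCols` says that the minor with rows `W, c, d` and columns `a, b, W` is
`pf(a W) pf(b W c d) - pf(b W) pf(a W c d)`. The matrix of `T_{k+1}^{r-1}` has only two nonzero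
entries in its first row, so that expansion along this row (`pf_window_of_short_row`) gives a
combination of `pf(a W c d)` and `pf(b W c d)`, where `a` and `b` are the second and the third row.
The minor is the determinant `T_k^{r-2}` (`pf_window_quadratic`). The node `r` follows by reversing
the order of the rows.

The theory of Pfaffians is built from their expansion along the first row (`pf_border`): the
coefficients of this expansion form a kernel vector of an odd skew-symmetric matrix
(`pfVec_vecMul`). All further identities, and Dodgson condensation, come from one form of Cramer's
rule, `det_mul_eq_of_vecMul_eq_single`, after cancelling a factor. That the factor may be assumed
nonzero is seen by joining the matrix by a segment, over the polynomial ring, to a matrix for which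
it is `1`.
-/

/-! ### The permutation sum of the Pfaffian -/

section PfaffianSum

variable {R : Type*} [CommRing R]

/-- The summand of the permutation expansion of the Pfaffian. -/
def pfTerm {n : ℕ} (A : Matrix (Fin (2 * n)) (Fin (2 * n)) R) (σ : Equiv.Perm (Fin (2 * n))) : R :=
  ((Equiv.Perm.sign σ : ℤ) : R) *
    ∏ i : Fin n, A (σ ⟨2 * i.1, by omega⟩) (σ ⟨2 * i.1 + 1, by omega⟩)

/-- `2 ^ n * n !` times the Pfaffian; it makes sense over every commutative ring. -/
def pfSum {n : ℕ} (A : Matrix (Fin (2 * n)) (Fin (2 * n)) R) : R :=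
  ∑ σ : Equiv.Perm (Fin (2 * n)), pfTerm A σ

/-- Renumbering rows and columns simultaneously multiplies the sum by the sign. -/
theorem pfSum_submatrix {n : ℕ} (A : Matrix (Fin (2 * n)) (Fin (2 * n)) R)
    (e : Equiv.Perm (Fin (2 * n))) :
    pfSum (A.submatrix e e) = ((Equiv.Perm.sign e : ℤ) : R) * pfSum A := by
  have hs : ((Equiv.Perm.sign e : ℤ) : R) * ((Equiv.Perm.sign e : ℤ) : R) = 1 := by
    rw [← Int.cast_mul, Int.units_coe_mul_self, Int.cast_one]
  unfold pfSum
  rw [Finset.mul_sum, ← Equiv.sum_comp (Equiv.mulLeft e) (fun σ => _ * pfTerm A σ)]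
  refine Finset.sum_congr rfl fun σ _ => ?_
  simp only [pfTerm, submatrix_apply, Equiv.coe_mulLeft, Equiv.Perm.sign_mul, Units.val_mul,
    Int.cast_mul, Equiv.Perm.mul_apply]
  rw [← mul_assoc, ← mul_assoc, hs, one_mul]

/-- The permutation that exchanges the first pair of positions with the pair number `i`. -/
def pairSwap {n : ℕ} (i : Fin (n + 1)) : Equiv.Perm (Fin (2 * (n + 1))) :=
  Equiv.swap ⟨0, by omega⟩ ⟨2 * i.1, by omega⟩ * Equiv.swap ⟨1, by omega⟩ ⟨2 * i.1 + 1, by omega⟩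

/-- Exchanging the first pair of positions with the pair number `i` does not change a summand. -/
theorem pfTerm_mul_pairSwap {n : ℕ} (A : Matrix (Fin (2 * (n + 1))) (Fin (2 * (n + 1))) R)
    (σ : Equiv.Perm (Fin (2 * (n + 1)))) (i : Fin (n + 1)) :
    pfTerm A (σ * pairSwap i) = pfTerm A σ := by
  unfold pfTerm pairSwap
  congr 1
  · by_cases h : i = 0
    · subst h
      simp
    · have h' : i.1 ≠ 0 := fun h0 => h (Fin.ext h0)
      rw [Equiv.Perm.sign_mul, Equiv.Perm.sign_mul, Equiv.Perm.sign_swap, Equiv.Perm.sign_swap]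
      · simp
      · simp
        omega
      · simp
        omega
  · rw [← Equiv.prod_comp (Equiv.swap 0 i)]
    refine Finset.prod_congr rfl fun k _ => ?_
    simp only [Equiv.Perm.mul_apply]
    congr 2
    all_goals
      simp only [Equiv.swap_apply_def, Fin.ext_iff, apply_ite Fin.val, Fin.val_zero]
      split_ifs <;> grind

/-- For a skew-symmetric matrix, reversing the first pair of positions does not change a
summand. -/
theorem pfTerm_mul_swap_zero_one {n : ℕ} (A : Matrix (Fin (2 * (n + 1))) (Fin (2 * (n + 1))) R)
    (hA : ∀ i j, A i j = -A j i) (σ : Equiv.Perm (Fin (2 * (n + 1)))) :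
    pfTerm A (σ * Equiv.swap ⟨0, by omega⟩ ⟨1, by omega⟩) = pfTerm A σ := by
  unfold pfTerm
  rw [Equiv.Perm.sign_mul, Equiv.Perm.sign_swap (by simp), Fin.prod_univ_succ, Fin.prod_univ_succ]
  simp only [Equiv.Perm.mul_apply, Fin.val_zero, mul_zero, zero_add, Equiv.swap_apply_left,
    Equiv.swap_apply_right]
  rw [hA (σ ⟨1, _⟩)]
  have : ∀ i : Fin n,
      A (σ ((Equiv.swap (⟨0, by omega⟩ : Fin (2 * (n + 1))) ⟨1, by omega⟩)
        ⟨2 * i.succ.1, by have := i.succ.2; omega⟩))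
        (σ ((Equiv.swap (⟨0, by omega⟩ : Fin (2 * (n + 1))) ⟨1, by omega⟩)
        ⟨2 * i.succ.1 + 1, by have := i.succ.2; omega⟩)) =
      A (σ ⟨2 * i.succ.1, by have := i.succ.2; omega⟩)
        (σ ⟨2 * i.succ.1 + 1, by have := i.succ.2; omega⟩) := by
    intro i
    rw [Equiv.swap_apply_of_ne_of_ne, Equiv.swap_apply_of_ne_of_ne] <;>
      simp only [ne_eq, Fin.mk.injEq, Fin.val_succ] <;> omega
  rw [Finset.prod_congr rfl fun i _ => this i]
  push_cast
  ring

/-- Any position `j` can be moved to the front without changing the summands. -/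
theorem exists_perm_pfTerm_mul {n : ℕ} (A : Matrix (Fin (2 * (n + 1))) (Fin (2 * (n + 1))) R)
    (hA : ∀ i j, A i j = -A j i) (j : Fin (2 * (n + 1))) :
    ∃ τ : Equiv.Perm (Fin (2 * (n + 1))), τ ⟨0, by omega⟩ = j ∧
      ∀ σ, pfTerm A (σ * τ) = pfTerm A σ := by
  obtain ⟨m, h⟩ := Nat.even_or_odd' j.1
  have hm : m < n + 1 := by
    have := j.2
    omega
  rcases h with h | h
  · obtain ⟨i, rfl⟩ : ∃ i : Fin (n + 1), i.1 = m := ⟨⟨m, hm⟩, rfl⟩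
    refine ⟨pairSwap i, ?_, fun σ => pfTerm_mul_pairSwap A σ i⟩
    have h1 : (Equiv.swap (⟨1, by omega⟩ : Fin (2 * (n + 1))) ⟨2 * i.1 + 1, by omega⟩)
        ⟨0, by omega⟩ = ⟨0, by omega⟩ :=
      Equiv.swap_apply_of_ne_of_ne (by simp only [ne_eq, Fin.mk.injEq]; omega)
        (by simp only [ne_eq, Fin.mk.injEq]; omega)
    rw [pairSwap, Equiv.Perm.mul_apply, h1, Equiv.swap_apply_left]
    exact Fin.ext h.symm
  · obtain ⟨i, rfl⟩ : ∃ i : Fin (n + 1), i.1 = m := ⟨⟨m, hm⟩, rfl⟩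
    refine ⟨pairSwap i * Equiv.swap ⟨0, by omega⟩ ⟨1, by omega⟩,
      ?_, fun σ => ?_⟩
    · have h1 : (Equiv.swap (⟨0, by omega⟩ : Fin (2 * (n + 1))) ⟨2 * i.1, by omega⟩)
          ⟨2 * i.1 + 1, by omega⟩ = ⟨2 * i.1 + 1, by omega⟩ :=
        Equiv.swap_apply_of_ne_of_ne (by simp only [ne_eq, Fin.mk.injEq]; omega)
          (by simp only [ne_eq, Fin.mk.injEq]; omega)
      rw [pairSwap, Equiv.Perm.mul_apply, Equiv.Perm.mul_apply, Equiv.swap_apply_left,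
        Equiv.swap_apply_left, h1]
      exact Fin.ext h.symm
    · rw [← mul_assoc, pfTerm_mul_swap_zero_one A hA, pfTerm_mul_pairSwap A σ i]

/-- Only the permutations that fix the first position are needed, by symmetry. -/
theorem pfSum_eq_sum_fix_zero {n : ℕ} (A : Matrix (Fin (2 * (n + 1))) (Fin (2 * (n + 1))) R)
    (hA : ∀ i j, A i j = -A j i) :
    pfSum A = (2 * (n + 1) : ℕ) *
      ∑ e : Equiv.Perm (Fin (2 * n + 1)), pfTerm A (Equiv.Perm.decomposeFin.symm (0, e)) := by
  -- The permutations are sorted by the position of the first row.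
  have key : ∀ j : Fin (2 * (n + 1)),
      ∑ σ : Equiv.Perm (Fin (2 * (n + 1))), (if σ j = ⟨0, by omega⟩ then pfTerm A σ else 0) =
      ∑ e : Equiv.Perm (Fin (2 * n + 1)), pfTerm A (Equiv.Perm.decomposeFin.symm (0, e)) := by
    intro j
    obtain ⟨τ, hτ, h⟩ := exists_perm_pfTerm_mul A hA j
    rw [← Equiv.sum_comp (Equiv.mulRight τ⁻¹)]
    have : ∀ σ : Equiv.Perm (Fin (2 * (n + 1))),
        (if (Equiv.mulRight τ⁻¹ σ) j = ⟨0, by omega⟩ then pfTerm A (Equiv.mulRight τ⁻¹ σ) else 0) =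
        if σ ⟨0, by omega⟩ = ⟨0, by omega⟩ then pfTerm A σ else 0 := by
      intro σ
      have h1 : (Equiv.mulRight τ⁻¹ σ) j = σ ⟨0, by omega⟩ := by
        simp [← hτ]
      have h2 : pfTerm A (Equiv.mulRight τ⁻¹ σ) = pfTerm A σ := by
        rw [← h (Equiv.mulRight τ⁻¹ σ)]
        simp
      rw [h1, h2]
    rw [Finset.sum_congr rfl fun σ _ => this σ]
    refine (Equiv.sum_comp (Equiv.Perm.decomposeFin (n := 2 * n + 1)).symm
      (fun σ : Equiv.Perm (Fin (2 * n + 1 + 1)) => if σ 0 = 0 then pfTerm A σ else 0)).symm.trans ?_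
    rw [Fintype.sum_prod_type]
    simp only [Equiv.Perm.decomposeFin_symm_apply_zero]
    rw [Finset.sum_eq_single 0]
    · simp
    · intro b _ hb
      simp [hb]
    · simp
  have : pfSum A = ∑ j : Fin (2 * (n + 1)), ∑ σ : Equiv.Perm (Fin (2 * (n + 1))),
      (if σ j = ⟨0, by omega⟩ then pfTerm A σ else 0) := by
    rw [Finset.sum_comm]
    refine Finset.sum_congr rfl fun σ _ => ?_
    rw [Finset.sum_eq_single (σ⁻¹ ⟨0, by omega⟩)]
    · simp
    · intro b _ hb
      rw [if_neg]
      intro h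
      exact hb (by simp [← h])
    · simp
  rw [this, Finset.sum_congr rfl fun j _ => key j]
  simp

/-- The order in which the rows other than the first and row `j + 1` are listed in the expansion
of a Pfaffian along its first row. Row `j + 1` is exchanged with row `1`, instead of the other rows
being kept in increasing order: then all signs in the expansion are `-1`, except for `j = 0`. -/
def skipPerm {m : ℕ} (j : Fin (m + 1)) (x : Fin m) : Fin (m + 1) := Equiv.swap 0 j x.succ

/-- Expansion along the first row. -/
theorem pfSum_succ {n : ℕ} (A : Matrix (Fin (2 * (n + 1))) (Fin (2 * (n + 1))) R)
    (hA : ∀ i j, A i j = -A j i) :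
    pfSum A = (2 * (n + 1) : ℕ) * ∑ j : Fin (2 * n + 1),
      (if j = 0 then 1 else -1) * A (0 : Fin (2 * n + 1 + 1)) j.succ *
        pfSum (A.submatrix (fun x : Fin (2 * n) => (skipPerm j x).succ)
          (fun x => (skipPerm j x).succ)) := by
  rw [pfSum_eq_sum_fix_zero A hA]
  congr 1
  rw [← Equiv.sum_comp (Equiv.Perm.decomposeFin (n := 2 * n)).symm, Fintype.sum_prod_type]
  refine Finset.sum_congr rfl fun j _ => ?_
  unfold pfSum
  rw [Finset.mul_sum]
  refine Finset.sum_congr rfl fun e _ => ?_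
  unfold pfTerm
  rw [Fin.prod_univ_succ]
  have hs : (Equiv.Perm.sign (Equiv.Perm.decomposeFin.symm
      ((0 : Fin (2 * n + 1 + 1)), Equiv.Perm.decomposeFin.symm (j, e)))) =
      (if j = 0 then 1 else -1) * Equiv.Perm.sign e := by
    rw [Equiv.Perm.decomposeFin.symm_sign, Equiv.Perm.decomposeFin.symm_sign]
    simp
  have h0 : (Equiv.Perm.decomposeFin.symm ((0 : Fin (2 * n + 1 + 1)),
      Equiv.Perm.decomposeFin.symm (j, e))) 0 = 0 := by simp
  have h1 : (Equiv.Perm.decomposeFin.symm ((0 : Fin (2 * n + 1 + 1)),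
      Equiv.Perm.decomposeFin.symm (j, e))) (Fin.succ 0) = j.succ := by
    rw [Equiv.Perm.decomposeFin_symm_apply_succ, Equiv.Perm.decomposeFin_symm_apply_zero]
    simp
  have h2 : ∀ x : Fin (2 * n), (Equiv.Perm.decomposeFin.symm ((0 : Fin (2 * n + 1 + 1)),
      Equiv.Perm.decomposeFin.symm (j, e))) x.succ.succ = (skipPerm j (e x)).succ := by
    intro x
    rw [Equiv.Perm.decomposeFin_symm_apply_succ, Equiv.Perm.decomposeFin_symm_apply_succ]
    simp [skipPerm]
  have hp : ∀ i : Fin n, A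
      ((Equiv.Perm.decomposeFin.symm ((0 : Fin (2 * n + 1 + 1)),
        Equiv.Perm.decomposeFin.symm (j, e))) ⟨2 * i.succ.1, by have := i.succ.2; omega⟩)
      ((Equiv.Perm.decomposeFin.symm ((0 : Fin (2 * n + 1 + 1)),
        Equiv.Perm.decomposeFin.symm (j, e))) ⟨2 * i.succ.1 + 1, by have := i.succ.2; omega⟩) =
      A (skipPerm j (e ⟨2 * i.1, by omega⟩)).succ
        (skipPerm j (e ⟨2 * i.1 + 1, by omega⟩)).succ := by
    intro i
    rw [← h2, ← h2]
    congr 2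
  rw [hs]
  refine Eq.trans (congrArg₂ (· * ·) rfl (congrArg₂ (· * ·) (congrArg₂ A h0 h1)
    (Finset.prod_congr rfl fun i _ => hp i))) ?_
  simp only [submatrix_apply]
  split_ifs <;> push_cast <;> ring

end PfaffianSum

/-! ### Pfaffians of bordered matrices -/

section Interpolation

open Polynomial

variable {R : Type} [CommRing R]

/-- The polySegment `(1 - X) M + X N` from `M` to `N`, as a matrix of polynomials. -/
noncomputable def polySegment {l m : Type*} (M N : Matrix l m R) : Matrix l m R[X] :=
  of fun i j => (1 - X) * C (M i j) + X * C (N i j)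

theorem polySegment_map_zero {l m : Type*} (M N : Matrix l m R) :
    (polySegment M N).map (evalRingHom 0) = M := by
  ext i j
  simp [polySegment]

theorem polySegment_map_one {l m : Type*} (M N : Matrix l m R) :
    (polySegment M N).map (evalRingHom 1) = N := by
  ext i j
  simp [polySegment]

theorem polySegment_skew {m : Type*} {M N : Matrix m m R} (hM : ∀ i j, M i j = -M j i)
    (hN : ∀ i j, N i j = -N j i) (i j : m) : polySegment M N i j = -polySegment M N j i := by
  simp only [polySegment, of_apply]
  rw [hM i j, hN i j]
  simp only [map_neg]
  ring

end Interpolation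

section Border

variable {R S : Type*} [CommRing R] [CommRing S]

/-- The matrix `K` bordered by the row `(0, a)` on the top and the column `(0, -a)` on the left. -/
def border {m : ℕ} (a : Fin m → R) (K : Matrix (Fin m) (Fin m) R) :
    Matrix (Fin (m + 1)) (Fin (m + 1)) R :=
  of fun i j => Fin.cases (Fin.cases 0 a j) (fun i' => Fin.cases (-a i') (K i') j) i

variable {m : ℕ} (a : Fin m → R) (K : Matrix (Fin m) (Fin m) R)

@[simp] theorem border_zero_zero : border a K 0 0 = 0 := rfl
@[simp] theorem border_zero_succ (j : Fin m) : border a K 0 j.succ = a j := rfl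
@[simp] theorem border_succ_zero (i : Fin m) : border a K i.succ 0 = -a i := rfl
@[simp] theorem border_succ_succ (i j : Fin m) : border a K i.succ j.succ = K i j := rfl

theorem border_skew (hK : ∀ i j, K i j = -K j i) (i j : Fin (m + 1)) :
    border a K i j = -border a K j i := by
  refine Fin.cases ?_ (fun i' => ?_) i <;> refine Fin.cases ?_ (fun j' => ?_) j
  · simp
  · simp
  · simp
  · simpa using hK i' j'

theorem border_map (f : R →+* S) :
    (border a K).map f = border (fun i => f (a i)) (K.map f) := by
  ext i j
  refine Fin.cases ?_ (fun i' => ?_) i <;> refine Fin.cases ?_ (fun j' => ?_) j <;> simp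

theorem border_submatrix_succ : (border a K).submatrix Fin.succ Fin.succ = K := rfl

theorem border_submatrix_castSucc (a : Fin (m + 1) → R) (K : Matrix (Fin (m + 1)) (Fin (m + 1)) R) :
    (border a K).submatrix Fin.castSucc Fin.castSucc =
      border (fun i => a i.castSucc) (K.submatrix Fin.castSucc Fin.castSucc) := by
  ext i j
  refine Fin.cases ?_ (fun i' => ?_) i <;> refine Fin.cases ?_ (fun j' => ?_) j <;>
    simp

theorem eq_border (A : Matrix (Fin (m + 1)) (Fin (m + 1)) R) (hA : ∀ i j, A i j = -A j i)
    (h0 : A 0 0 = 0) :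
    A = border (fun j => A 0 j.succ) (A.submatrix Fin.succ Fin.succ) := by
  ext i j
  refine Fin.cases ?_ (fun i' => ?_) i <;> refine Fin.cases ?_ (fun j' => ?_) j
  · simpa using h0
  · simp
  · simpa using hA _ _
  · simp

/-- The skew-symmetric tridiagonal matrix with ones above the diagonal; all its Pfaffians over
intervals of even length are `1`. -/
def skewTridiagonal (R : Type*) [CommRing R] (m : ℕ) : Matrix (Fin m) (Fin m) R :=
  of fun i j => if j.1 = i.1 + 1 then 1 else if i.1 = j.1 + 1 then -1 else 0

theorem skewTridiagonal_skew (m : ℕ) (i j : Fin m) :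
    skewTridiagonal R m i j = -skewTridiagonal R m j i := by
  simp only [skewTridiagonal, of_apply]
  split_ifs <;> first | omega | simp

theorem skewTridiagonal_succ (m : ℕ) :
    skewTridiagonal R (m + 1) =
      border (fun j => if j.1 = 0 then 1 else 0) (skewTridiagonal R m) := by
  ext i j
  refine Fin.cases ?_ (fun i' => ?_) i <;> refine Fin.cases ?_ (fun j' => ?_) j <;>
    simp [skewTridiagonal]
  split_ifs <;> simp

theorem skewTridiagonal_castSucc (m : ℕ) :
    (skewTridiagonal R (m + 1)).submatrix Fin.castSucc Fin.castSucc = skewTridiagonal R m := by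
  ext i j
  simp [skewTridiagonal]

end Border

section Pfaffian

variable {R S : Type*} [CommRing R] [Algebra ℚ R] [CommRing S] [Algebra ℚ S]

/-- The Pfaffian over a `ℚ`-algebra. -/
def pf (n : ℕ) (A : Matrix (Fin (2 * n)) (Fin (2 * n)) R) : R :=
  ((2 : ℚ) ^ n * (n.factorial : ℚ))⁻¹ • pfSum A

theorem pf_map (f : R →+* S) (n : ℕ) (A : Matrix (Fin (2 * n)) (Fin (2 * n)) R) :
    pf n (A.map f) = f (pf n A) := by
  unfold pf pfSum pfTerm
  rw [map_rat_smul f]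
  simp

theorem pf_submatrix_perm (n : ℕ) (A : Matrix (Fin (2 * n)) (Fin (2 * n)) R)
    (e : Equiv.Perm (Fin (2 * n))) :
    pf n (A.submatrix e e) = ((Equiv.Perm.sign e : ℤ) : R) * pf n A := by
  rw [pf, pf, pfSum_submatrix, mul_smul_comm]

@[simp] theorem pf_zero (A : Matrix (Fin (2 * 0)) (Fin (2 * 0)) R) : pf 0 A = 1 := by
  simp only [pf, pfSum, pfTerm, Finset.univ_eq_empty, Finset.prod_empty]
  have : Subsingleton (Equiv.Perm (Fin (2 * 0))) :=
    inferInstanceAs (Subsingleton (Equiv.Perm (Fin 0)))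
  rw [Fintype.sum_subsingleton _ (1 : Equiv.Perm (Fin (2 * 0)))]
  simp

/-- The coefficients of the Pfaffian of a bordered matrix, as a linear form in the border. Up to
sign these are the Pfaffians of the matrix with one row and column removed. -/
def pfVec (n : ℕ) (K : Matrix (Fin (2 * n + 1)) (Fin (2 * n + 1)) R) (j : Fin (2 * n + 1)) : R :=
  (if j = 0 then 1 else -1) * pf n (K.submatrix (skipPerm j) (skipPerm j))

/-- Expansion of a Pfaffian along its first row. -/
theorem pf_border (n : ℕ) (a : Fin (2 * n + 1) → R)
    (K : Matrix (Fin (2 * n + 1)) (Fin (2 * n + 1)) R) (hK : ∀ i j, K i j = -K j i) :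
    pf (n + 1) (border a K) = pfVec n K ⬝ᵥ a := by
  unfold pf
  rw [pfSum_succ (n := n) (border a K) (border_skew a K hK), dotProduct, Finset.mul_sum,
    Finset.smul_sum]
  refine Finset.sum_congr rfl fun j _ => ?_
  have h : (border a K).submatrix (fun x : Fin (2 * n) => (skipPerm j x).succ)
      (fun x => (skipPerm j x).succ) = K.submatrix (skipPerm j) (skipPerm j) := rfl
  rw [h, border_zero_succ, pfVec, pf, mul_smul_comm, smul_mul_assoc]
  have h2 : ((2 * (n + 1) : ℕ) : R) = algebraMap ℚ R ((2 * (n + 1) : ℕ) : ℚ) := by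
    rw [map_natCast]
  rw [h2, ← Algebra.smul_def, smul_smul, mul_right_comm]
  congr 1
  · rw [pow_succ, Nat.factorial_succ]
    have : (n.factorial : ℚ) ≠ 0 := by exact_mod_cast n.factorial_ne_zero
    push_cast
    field_simp

theorem pfVec_zero (n : ℕ) (K : Matrix (Fin (2 * n + 1)) (Fin (2 * n + 1)) R) :
    pfVec n K 0 = pf n (K.submatrix Fin.succ Fin.succ) := by
  have : skipPerm (0 : Fin (2 * n + 1)) = Fin.succ := by
    ext x
    simp [skipPerm]
  rw [pfVec, this]
  simp

theorem skipPerm_last (m : ℕ) : skipPerm (Fin.last m) = Fin.castSucc ∘ finRotate m := by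
  cases m with
  | zero => exact Subsingleton.elim _ _
  | succ m =>
    ext x
    refine Fin.lastCases ?_ (fun i => ?_) x
    · simp [skipPerm]
    · have : i.castSucc.succ ≠ Fin.last (m + 1) := by
        rw [ne_eq, Fin.ext_iff, Fin.val_succ, Fin.val_castSucc, Fin.val_last]
        omega
      simp only [skipPerm, Function.comp]
      rw [Equiv.swap_apply_of_ne_of_ne (Fin.succ_ne_zero _) this]
      simp

/-- The last coefficient is the Pfaffian without the last row, with no sign: the sign `-1` in `pfVec`
cancels the sign of the cyclic permutation of the `2n` other rows. -/
theorem pfVec_last (n : ℕ) (K : Matrix (Fin (2 * n + 1)) (Fin (2 * n + 1)) R) :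
    pfVec n K (Fin.last _) = pf n (K.submatrix Fin.castSucc Fin.castSucc) := by
  cases n with
  | zero =>
    simp [pfVec]
  | succ n =>
    have h2 : K.submatrix (skipPerm (Fin.last (2 * (n + 1)))) (skipPerm (Fin.last (2 * (n + 1)))) =
        (K.submatrix Fin.castSucc Fin.castSucc).submatrix (finRotate (2 * (n + 1)))
          (finRotate (2 * (n + 1))) := by
      rw [skipPerm_last]
      rfl
    rw [pfVec, h2]
    have h3 := pf_submatrix_perm (n + 1) (K.submatrix Fin.castSucc Fin.castSucc)
      (finRotate (2 * (n + 1)))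
    have h4 : Equiv.Perm.sign (finRotate (2 * (n + 1))) = -1 := by
      rw [sign_finRotate]
      exact Odd.neg_one_pow ⟨n, by omega⟩
    rw [h3, if_neg, h4]
    · simp
    · simp [Fin.ext_iff]

/-- The vector of Pfaffians is in the kernel: a Pfaffian with two equal rows vanishes. -/
theorem pfVec_vecMul [IsDomain R] (n : ℕ) (K : Matrix (Fin (2 * n + 1)) (Fin (2 * n + 1)) R)
    (hK : ∀ i j, K i j = -K j i) : pfVec n K ᵥ* K = 0 := by
  have : CharZero R := algebraRat.charZero R
  ext w
  have hA := border_skew (K w) K hK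
  have hrow : ∀ j, border (K w) K 0 j = border (K w) K w.succ j := by
    intro j
    refine Fin.cases ?_ (fun j' => ?_) j
    · have := self_eq_neg.mp (hK w w)
      simp [this]
    · simp
  have hsw : ∀ i j, border (K w) K (Equiv.swap 0 w.succ i) j = border (K w) K i j := by
    intro i j
    by_cases h0 : i = 0
    · rw [h0, Equiv.swap_apply_left, hrow]
    · by_cases h1 : i = w.succ
      · rw [h1, Equiv.swap_apply_right, hrow]
      · rw [Equiv.swap_apply_of_ne_of_ne h0 h1]
  have hsub : (border (K w) K).submatrix (Equiv.swap 0 w.succ) (Equiv.swap 0 w.succ) =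
      border (K w) K := by
    ext i j
    rw [submatrix_apply, hsw, hA, hsw, ← hA]
  have h := pf_submatrix_perm (n + 1) (border (K w) K) (Equiv.swap (0 : Fin (2 * n + 1 + 1)) w.succ)
  rw [Equiv.Perm.sign_swap (Fin.succ_ne_zero w).symm] at h
  have h' : pf (n + 1) (border (K w) K) = -pf (n + 1) (border (K w) K) := by
    refine (congrArg (pf (n + 1)) hsub).symm.trans (h.trans ?_)
    simp
  have h0 := self_eq_neg.mp h'
  rw [pf_border n _ K hK] at h0
  rw [Pi.zero_apply, vecMul, dotProduct_comm, ← neg_eq_zero]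
  rw [dotProduct_comm] at h0
  rw [← h0, dotProduct, dotProduct, ← Finset.sum_neg_distrib]
  refine Finset.sum_congr rfl fun x _ => ?_
  rw [hK w x]
  ring

theorem pf_skewTridiagonal (n : ℕ) : pf n (skewTridiagonal R (2 * n)) = 1 := by
  induction n with
  | zero => simp
  | succ n ih =>
    have h : skewTridiagonal R (2 * n + 1 + 1) = _ := skewTridiagonal_succ (2 * n + 1)
    refine (congrArg (pf (n + 1)) h).trans ?_
    rw [pf_border n _ _ (skewTridiagonal_skew _), dotProduct, Finset.sum_eq_single 0]
    · rw [pfVec_zero, skewTridiagonal_succ (2 * n)]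
      rw [border_submatrix_succ, ih]
      simp
    · intro b _ hb
      have : b.1 ≠ 0 := fun h => hb (Fin.ext h)
      simp [this]
    · simp

end Pfaffian

/-! ### Determinants and Pfaffians of skew-symmetric matrices, and condensation -/

section CramerRule

variable {R : Type*} [CommRing R] {m : Type*} [Fintype m] [DecidableEq m]

/-- If `v` annihilates all columns of `N` except one, then `det N • v` is proportional to a row of
the adjugate. -/
theorem det_mul_eq_of_vecMul_eq_single {N : Matrix m m R} {v : m → R} {i : m} {c : R}
    (h : v ᵥ* N = Pi.single i c) (j : m) : N.det * v j = c * N.adjugate i j := by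
  have h2 : v ᵥ* N ᵥ* N.adjugate = N.det • v := by
    rw [vecMul_vecMul, mul_adjugate, vecMul_smul, vecMul_one]
  have h3 := congrFun h2 j
  rw [h, single_vecMul, Pi.smul_apply, Pi.smul_apply, smul_eq_mul, smul_eq_mul] at h3
  exact h3.symm

theorem adjugate_eq_det_updateCol (A : Matrix m m R) (i j : m) :
    A.adjugate i j = (A.updateCol i (Pi.single j 1)).det := by
  rw [← cramer_apply, cramer_eq_adjugate_mulVec, mulVec_single_one]
  rfl

end CramerRule

section PfaffianIdentities

/-- The adjugate of a skew-symmetric matrix of odd size is symmetric. -/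
theorem adjugate_comm_of_skew {R : Type*} [CommRing R] {n : ℕ}
    (K : Matrix (Fin (2 * n + 1)) (Fin (2 * n + 1)) R) (hK : ∀ i j, K i j = -K j i)
    (i j : Fin (2 * n + 1)) : K.adjugate i j = K.adjugate j i := by
  have h : Kᵀ = (-1 : R) • K := by
    ext i j
    simpa using hK j i
  have h2 := congrFun (congrFun (adjugate_transpose K) j) i
  rw [h, adjugate_smul] at h2
  simpa using h2

/-- The first row of the adjugate of a skew-symmetric matrix `K` of odd size, for `K` such that the
Pfaffian without the first row does not vanish and its square is the corresponding minor. -/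
theorem adjugate_zero_eq_of_pfVec_ne_zero {R : Type*} [CommRing R] [IsDomain R] [Algebra ℚ R]
    {n : ℕ} (K : Matrix (Fin (2 * n + 1)) (Fin (2 * n + 1)) R) (hK : ∀ i j, K i j = -K j i)
    (hdet : (K.submatrix Fin.succ Fin.succ).det = pf n (K.submatrix Fin.succ Fin.succ) ^ 2)
    (h0 : pfVec n K 0 ≠ 0) (x : Fin (2 * n + 1)) :
    K.adjugate 0 x = pfVec n K 0 * pfVec n K x := by
  -- `det N` is the required entry, and the kernel vector of `K` annihilates all other columns.
  set N := K.updateCol 0 (Pi.single x 1) with hN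
  have hv : pfVec n K ᵥ* N = Pi.single 0 (pfVec n K x) := by
    ext j
    by_cases hj : j = 0
    · subst hj
      simp [hN, vecMul]
    · have := congrFun (pfVec_vecMul n K hK) j
      simp only [vecMul, Pi.zero_apply] at this
      simpa [hN, vecMul, hj] using this
  have h1 := det_mul_eq_of_vecMul_eq_single hv 0
  have h2 : N.adjugate 0 0 = pfVec n K 0 ^ 2 := by
    rw [adjugate_fin_succ_eq_det_submatrix, pfVec_zero, ← hdet]
    simp only [Fin.succAbove_zero, Fin.val_zero, add_zero, pow_zero, one_mul]
    congr 1
  rw [h2, ← adjugate_eq_det_updateCol] at h1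
  refine mul_right_cancel₀ h0 ?_
  rw [h1]
  ring

/-- The determinant of a skew-symmetric matrix of even size is the square of its Pfaffian, when the
Pfaffian without the first two rows does not vanish. -/
theorem det_border_eq_of_pfVec_ne_zero {R : Type*} [CommRing R] [IsDomain R] [Algebra ℚ R]
    {n : ℕ} (K : Matrix (Fin (2 * n + 1)) (Fin (2 * n + 1)) R) (hK : ∀ i j, K i j = -K j i)
    (hdet : (K.submatrix Fin.succ Fin.succ).det = pf n (K.submatrix Fin.succ Fin.succ) ^ 2)
    (h0 : pfVec n K 0 ≠ 0) (a : Fin (2 * n + 1) → R) :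
    (border a K).det = pf (n + 1) (border a K) ^ 2 := by
  -- The kernel vector of `K` pairs with the border to the Pfaffian.
  have hv : (Fin.cons 0 (pfVec n K) : Fin (2 * n + 1 + 1) → R) ᵥ* border a K =
      Pi.single 0 (-pf (n + 1) (border a K)) := by
    ext j
    refine Fin.cases ?_ (fun j' => ?_) j
    · rw [pf_border n a K hK]
      simp [vecMul, dotProduct, Fin.sum_univ_succ]
    · have := congrFun (pfVec_vecMul n K hK) j'
      simpa [vecMul, dotProduct, Fin.sum_univ_succ] using this
  have h1 := det_mul_eq_of_vecMul_eq_single hv (Fin.succ 0)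
  have h2 : (border a K).adjugate 0 (Fin.succ 0) = -(pfVec n K 0 * pf (n + 1) (border a K)) := by
    rw [adjugate_fin_succ_eq_det_submatrix]
    have : (border a K).submatrix (Fin.succAbove (Fin.succ 0)) (Fin.succAbove 0) =
        K.updateRow 0 a := by
      ext i j
      refine Fin.cases ?_ (fun i' => ?_) i
      · simp
      · simp
    rw [this, ← cramer_transpose_apply, cramer_eq_adjugate_mulVec, ← adjugate_transpose]
    rw [mulVec, pf_border n a K hK, dotProduct, dotProduct, Finset.mul_sum]
    simp only [transpose_apply, adjugate_comm_of_skew K hK _ 0,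
      adjugate_zero_eq_of_pfVec_ne_zero K hK hdet h0, mul_assoc, ← Finset.mul_sum]
    simp
  rw [h2] at h1
  refine mul_right_cancel₀ h0 ?_
  rw [Fin.cons_succ] at h1
  rw [h1]
  ring

open Polynomial in
/-- The determinant of a skew-symmetric matrix of even size is the square of its Pfaffian. The
statement is for all domains at once, because the induction step passes from `R` to `R[X]`. -/
theorem det_eq_pf_sq (n : ℕ) : ∀ {R : Type} [CommRing R] [IsDomain R] [Algebra ℚ R]
    (A : Matrix (Fin (2 * n)) (Fin (2 * n)) R), (∀ i j, A i j = -A j i) → A.det = pf n A ^ 2 := by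
  induction n with
  | zero =>
    intro R _ _ _ A _
    rw [pf_zero, one_pow]
    exact det_fin_zero
  | succ n ih =>
    intro R _ _ _ A hA
    have : CharZero R := algebraRat.charZero R
    let B : Matrix (Fin (2 * n + 1 + 1)) (Fin (2 * n + 1 + 1)) R[X] :=
      polySegment A (skewTridiagonal R (2 * n + 1 + 1))
    have hB : ∀ i j, B i j = -B j i := polySegment_skew hA (skewTridiagonal_skew _)
    have hb := eq_border B hB (self_eq_neg.mp (hB 0 0))
    have key := det_border_eq_of_pfVec_ne_zero (n := n) (B.submatrix Fin.succ Fin.succ)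
      (fun i j => hB _ _) (ih _ fun i j => hB _ _) (fun h => by
        have h1 := congrArg (evalRingHom (1 : R)) h
        rw [pfVec_zero, ← pf_map, map_zero] at h1
        have h2 : ((B.submatrix Fin.succ Fin.succ).submatrix Fin.succ Fin.succ).map
            (evalRingHom (1 : R)) = skewTridiagonal R (2 * n) := by
          change ((B.map (evalRingHom (1 : R))).submatrix Fin.succ Fin.succ).submatrix
            Fin.succ Fin.succ = _
          rw [polySegment_map_one, skewTridiagonal_succ, border_submatrix_succ,
            skewTridiagonal_succ, border_submatrix_succ]
        rw [h2, pf_skewTridiagonal] at h1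
        exact one_ne_zero h1) (fun j => B 0 j.succ)
    rw [← hb] at key
    have h3 := congrArg (evalRingHom (0 : R)) key
    rw [RingHom.map_det, map_pow, ← pf_map] at h3
    have h4 : B.map (evalRingHom (0 : R)) = A := polySegment_map_zero _ _
    rw [RingHom.mapMatrix_apply, h4] at h3
    exact h3

theorem pfVec_map {R S : Type*} [CommRing R] [Algebra ℚ R] [CommRing S] [Algebra ℚ S] (f : R →+* S)
    (n : ℕ) (K : Matrix (Fin (2 * n + 1)) (Fin (2 * n + 1)) R) (j : Fin (2 * n + 1)) :
    pfVec n (K.map f) j = f (pfVec n K j) := by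
  rw [pfVec, pfVec, submatrix_map, pf_map]
  split_ifs <;> simp

open Polynomial in
/-- The first row of the adjugate of a skew-symmetric matrix of odd size. -/
theorem adjugate_zero_eq {R : Type} [CommRing R] [IsDomain R] [Algebra ℚ R] {n : ℕ}
    (K : Matrix (Fin (2 * n + 1)) (Fin (2 * n + 1)) R) (hK : ∀ i j, K i j = -K j i)
    (x : Fin (2 * n + 1)) : K.adjugate 0 x = pfVec n K 0 * pfVec n K x := by
  let B : Matrix (Fin (2 * n + 1)) (Fin (2 * n + 1)) R[X] :=
    polySegment K (skewTridiagonal R (2 * n + 1))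
  have hB : ∀ i j, B i j = -B j i := polySegment_skew hK (skewTridiagonal_skew _)
  have key := adjugate_zero_eq_of_pfVec_ne_zero B hB (det_eq_pf_sq _ _ fun i j => hB _ _)
    (fun h => by
      have h1 := congrArg (evalRingHom (1 : R)) h
      rw [← pfVec_map, polySegment_map_one, pfVec_zero, skewTridiagonal_succ,
        border_submatrix_succ, pf_skewTridiagonal, map_zero] at h1
      exact one_ne_zero h1) x
  have h3 := congrArg (evalRingHom (0 : R)) key
  have h4 : B.map (evalRingHom (0 : R)) = K := polySegment_map_zero _ _
  have h5 := congrFun (congrFun (RingHom.map_adjugate (evalRingHom (0 : R)) B) 0) x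
  rw [RingHom.mapMatrix_apply, RingHom.mapMatrix_apply, h4, map_apply] at h5
  rw [map_mul, ← pfVec_map, ← pfVec_map, h4, h5] at h3
  exact h3

/-- For a skew-symmetric matrix of odd size, the minor without the last row and the first column is
the product of the Pfaffians of the two leading intervals. -/
theorem det_succ_castSucc_eq_pf_mul_pf {R : Type} [CommRing R] [IsDomain R] [Algebra ℚ R] {n : ℕ}
    (K : Matrix (Fin (2 * n + 1)) (Fin (2 * n + 1)) R) (hK : ∀ i j, K i j = -K j i) :
    (K.submatrix Fin.castSucc Fin.succ).det =
      pf n (K.submatrix Fin.castSucc Fin.castSucc) * pf n (K.submatrix Fin.succ Fin.succ) := by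
  have h := adjugate_zero_eq K hK (Fin.last _)
  rw [adjugate_fin_succ_eq_det_submatrix, pfVec_zero, pfVec_last] at h
  simp only [Fin.val_last, Fin.val_zero, add_zero, Fin.succAbove_last, Fin.succAbove_zero] at h
  rw [pow_mul, neg_one_sq, one_pow, one_mul] at h
  rw [h, mul_comm]

/-- The transpose of `det_succ_castSucc_eq_pf_mul_pf`. -/
theorem det_castSucc_succ_eq_pf_mul_pf {R : Type} [CommRing R] [IsDomain R] [Algebra ℚ R] {n : ℕ}
    (K : Matrix (Fin (2 * n + 1)) (Fin (2 * n + 1)) R) (hK : ∀ i j, K i j = -K j i) :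
    (K.submatrix Fin.succ Fin.castSucc).det =
      pf n (K.submatrix Fin.castSucc Fin.castSucc) * pf n (K.submatrix Fin.succ Fin.succ) := by
  rw [← det_succ_castSucc_eq_pf_mul_pf K hK]
  have h : K.submatrix Fin.succ Fin.castSucc = (-(K.submatrix Fin.castSucc Fin.succ))ᵀ := by
    ext i j
    simpa using hK _ _
  rw [h, det_transpose, det_neg]
  simp

/-- The matrix with columns `a`, `b` and the columns of `K` except the last two. -/
def consTwoCols {R : Type*} {m : ℕ} (a b : Fin (m + 2) → R)
    (K : Matrix (Fin (m + 2)) (Fin (m + 2)) R) : Matrix (Fin (m + 2)) (Fin (m + 2)) R :=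
  of fun i => Fin.cons (a i) (Fin.cons (b i) fun w => K i w.castSucc.castSucc)

/-- The quadratic identity `det_consTwoCols`, when two of the Pfaffians do not vanish. -/
theorem det_consTwoCols_of_ne_zero {R : Type} [CommRing R] [IsDomain R] [Algebra ℚ R] {n : ℕ}
    (a b : Fin (2 * n + 1 + 2) → R)
    (K : Matrix (Fin (2 * n + 1 + 2)) (Fin (2 * n + 1 + 2)) R) (hK : ∀ i j, K i j = -K j i)
    (hb : pf (n + 1) (border (m := 2 * n + 1) (fun i => b i.castSucc.castSucc)
      (K.submatrix (fun i : Fin (2 * n + 1) => i.castSucc.castSucc)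
        (fun i => i.castSucc.castSucc))) ≠ 0)
    (hc : pf (n + 1) (K.submatrix Fin.castSucc Fin.castSucc) ≠ 0) :
    (consTwoCols a b K).det =
      pf (n + 1) (border (m := 2 * n + 1) (fun i => a i.castSucc.castSucc)
        (K.submatrix (fun i : Fin (2 * n + 1) => i.castSucc.castSucc)
          (fun i => i.castSucc.castSucc))) * pf (n + 2) (border (m := 2 * n + 1 + 2) b K) -
      pf (n + 1) (border (m := 2 * n + 1) (fun i => b i.castSucc.castSucc)
        (K.submatrix (fun i : Fin (2 * n + 1) => i.castSucc.castSucc)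
          (fun i => i.castSucc.castSucc))) * pf (n + 2) (border (m := 2 * n + 1 + 2) a K) := by
  set W := K.submatrix (fun i : Fin (2 * n + 1) => i.castSucc.castSucc)
    (fun i : Fin (2 * n + 1) => i.castSucc.castSucc) with hW
  have hWs : ∀ i j, W i j = -W j i := fun i j => hK _ _
  set p : Fin (2 * n + 1 + 2) → R := pfVec (n + 1) K with hp
  set q : Fin (2 * n + 1 + 2) → R := Fin.snoc (Fin.snoc (pfVec n W) 0 : Fin (2 * n + 2) → R) 0
    with hq
  have pa : ∀ a, pf (n + 2) (border (m := 2 * n + 1 + 2) a K) = p ⬝ᵥ a :=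
    fun a => pf_border (n + 1) a K hK
  have qa : ∀ a : Fin (2 * n + 1 + 2) → R,
      pf (n + 1) (border (m := 2 * n + 1) (fun i => a i.castSucc.castSucc) W) = q ⬝ᵥ a := by
    intro a
    rw [pf_border n _ W hWs]
    simp [dotProduct, Fin.sum_univ_castSucc, hq]
  rw [qa] at hb
  rw [qa, qa, pa, pa]
  have hpK : p ᵥ* K = 0 := pfVec_vecMul (n + 1) K hK
  have hqK : ∀ w : Fin (2 * n + 1), q ⬝ᵥ (fun i => K i w.castSucc.castSucc) = 0 := by
    intro w
    rw [← qa]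
    have := congrFun (pfVec_vecMul n W hWs) w
    rw [pf_border n _ W hWs]
    exact this
  -- `p` and `q` annihilate the columns of `K` in question; this combination annihilates `b` too.
  have hv : ((p ⬝ᵥ b) • q - (q ⬝ᵥ b) • p) ᵥ* consTwoCols a b K =
      Pi.single 0 ((p ⬝ᵥ b) * (q ⬝ᵥ a) - (q ⬝ᵥ b) * (p ⬝ᵥ a)) := by
    ext j
    rw [sub_vecMul, smul_vecMul, smul_vecMul]
    refine Fin.cases ?_ (fun j' => Fin.cases ?_ (fun w => ?_) j') j
    · rfl
    · have h1 : (q ᵥ* consTwoCols a b K) (Fin.succ 0) = q ⬝ᵥ b := rfl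
      have h2 : (p ᵥ* consTwoCols a b K) (Fin.succ 0) = p ⬝ᵥ b := rfl
      simp only [Pi.sub_apply, Pi.smul_apply, h1, h2, smul_eq_mul]
      rw [Pi.single_eq_of_ne (Fin.succ_ne_zero _)]
      ring
    · have h1 : (q ᵥ* consTwoCols a b K) w.succ.succ = 0 := hqK w
      have h2 : (p ᵥ* consTwoCols a b K) w.succ.succ = 0 := congrFun hpK w.castSucc.castSucc
      simp only [Pi.sub_apply, Pi.smul_apply, h1, h2, smul_eq_mul]
      rw [Pi.single_eq_of_ne (Fin.succ_ne_zero _)]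
      ring
  have h1 := det_mul_eq_of_vecMul_eq_single hv (Fin.last _)
  have hql : q (Fin.last _) = 0 := by simp [hq]
  have hpl : p (Fin.last _) = pf (n + 1) (K.submatrix Fin.castSucc Fin.castSucc) :=
    pfVec_last (n + 1) K
  have hadj : (consTwoCols a b K).adjugate 0 (Fin.last _) = -((q ⬝ᵥ b) * p (Fin.last _)) := by
    -- The cofactor is a minor of a skew-symmetric matrix of odd size: a product of Pfaffians.
    rw [adjugate_fin_succ_eq_det_submatrix, hpl]
    let L := border (fun i => -b i.castSucc) (K.submatrix Fin.castSucc Fin.castSucc)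
    have hL : (consTwoCols a b K).submatrix (Fin.succAbove (Fin.last _)) (Fin.succAbove 0) =
        L.submatrix Fin.succ Fin.castSucc := by
      ext i j
      refine Fin.cases ?_ (fun j' => ?_) j
      · simp [consTwoCols, L]
      · simp [consTwoCols, L]
    have hLs := border_skew (fun i => -b i.castSucc) (K.submatrix Fin.castSucc Fin.castSucc)
      (fun i j => hK _ _)
    have hLW : L.submatrix Fin.castSucc Fin.castSucc =
        border (fun i => (-b) i.castSucc.castSucc) W := border_submatrix_castSucc _ _
    have h2 := det_castSucc_succ_eq_pf_mul_pf (n := n + 1) L hLs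
    have h3 : pf (n + 1) (L.submatrix Fin.castSucc Fin.castSucc) = -(q ⬝ᵥ b) := by
      refine (congrArg (pf (n + 1)) hLW).trans ?_
      rw [qa, dotProduct_neg]
    rw [hL]
    refine (congrArg₂ (· * ·) rfl (h2.trans (congrArg₂ (· * ·) h3 rfl))).trans ?_
    have h4 : L.submatrix Fin.succ Fin.succ = K.submatrix Fin.castSucc Fin.castSucc := rfl
    rw [h4]
    simp [pow_succ, pow_mul]
  rw [hadj] at h1
  simp only [Pi.sub_apply, Pi.smul_apply, hql, smul_eq_mul, mul_zero, zero_sub] at h1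
  rw [← hpl] at hc
  refine mul_right_cancel₀ (mul_ne_zero hb hc) ?_
  linear_combination -h1

open Polynomial in
/-- A quadratic Pfaffian identity: a minor of a skew-symmetric matrix with an odd number of common
rows and columns, two further rows and two further columns `a`, `b`, is a difference of two products
of Pfaffians. -/
theorem det_consTwoCols {R : Type} [CommRing R] [IsDomain R] [Algebra ℚ R] {n : ℕ}
    (a b : Fin (2 * n + 1 + 2) → R)
    (K : Matrix (Fin (2 * n + 1 + 2)) (Fin (2 * n + 1 + 2)) R) (hK : ∀ i j, K i j = -K j i) :
    (consTwoCols a b K).det =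
      pf (n + 1) (border (m := 2 * n + 1) (fun i => a i.castSucc.castSucc)
        (K.submatrix (fun i : Fin (2 * n + 1) => i.castSucc.castSucc)
          (fun i => i.castSucc.castSucc))) * pf (n + 2) (border (m := 2 * n + 1 + 2) b K) -
      pf (n + 1) (border (m := 2 * n + 1) (fun i => b i.castSucc.castSucc)
        (K.submatrix (fun i : Fin (2 * n + 1) => i.castSucc.castSucc)
          (fun i => i.castSucc.castSucc))) * pf (n + 2) (border (m := 2 * n + 1 + 2) a K) := by
  let B : Matrix (Fin (2 * n + 1 + 2 + 1)) (Fin (2 * n + 1 + 2 + 1)) R[X] :=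
    polySegment (border b K) (skewTridiagonal R (2 * n + 1 + 2 + 1))
  have hB : ∀ i j, B i j = -B j i := polySegment_skew (border_skew b K hK) (skewTridiagonal_skew _)
  have hB1 : B.map (evalRingHom (1 : R)) = skewTridiagonal R (2 * n + 1 + 2 + 1) :=
    polySegment_map_one _ _
  have hB0 : B.map (evalRingHom (0 : R)) = border b K := polySegment_map_zero _ _
  let K' := B.submatrix Fin.succ Fin.succ
  let b' : Fin (2 * n + 1 + 2) → R[X] := fun j => B 0 j.succ
  have hK0 : K'.map (evalRingHom (0 : R)) = K :=
    congrArg (fun M => M.submatrix Fin.succ Fin.succ) hB0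
  have hK1 : K'.map (evalRingHom (1 : R)) = skewTridiagonal R (2 * n + 1 + 2) := by
    refine (congrArg (fun M => M.submatrix Fin.succ Fin.succ) hB1).trans ?_
    rw [skewTridiagonal_succ, border_submatrix_succ]
  have hb0 : ∀ j, evalRingHom (0 : R) (b' j) = b j := fun j =>
    congrFun (congrFun hB0 0) j.succ
  have hb1 : ∀ j, evalRingHom (1 : R) (b' j) = if j.1 = 0 then 1 else 0 := fun j => by
    refine (congrFun (congrFun hB1 0) j.succ).trans ?_
    rw [skewTridiagonal_succ, border_zero_succ]
  have key := det_consTwoCols_of_ne_zero (fun j => C (a j)) b' K' (fun i j => hB _ _)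
    (fun h => by
      have h1 := congrArg (evalRingHom (1 : R)) h
      rw [← pf_map, map_zero] at h1
      have h2 : (border (m := 2 * n + 1) (fun i => b' i.castSucc.castSucc)
          (K'.submatrix (fun i : Fin (2 * n + 1) => i.castSucc.castSucc)
          (fun i => i.castSucc.castSucc))).map (evalRingHom (1 : R)) =
          skewTridiagonal R (2 * n + 1 + 1) := by
        have h4 : (skewTridiagonal R (2 * n + 1 + 2)).submatrix
            (fun i : Fin (2 * n + 1) => i.castSucc.castSucc) (fun i => i.castSucc.castSucc) =
            skewTridiagonal R (2 * n + 1) := rfl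
        rw [border_map, ← submatrix_map, hK1, h4, skewTridiagonal_succ (2 * n + 1)]
        congr 1
        funext i
        exact hb1 _
      exact one_ne_zero (((pf_skewTridiagonal (n + 1)).symm.trans
        (congrArg (pf (n + 1)) h2.symm)).trans h1))
    (fun h => by
      have h1 := congrArg (evalRingHom (1 : R)) h
      rw [← pf_map, map_zero] at h1
      have h2 : (K'.submatrix Fin.castSucc Fin.castSucc).map (evalRingHom (1 : R)) =
          skewTridiagonal R (2 * n + 1 + 1) := by
        rw [← submatrix_map, hK1, skewTridiagonal_castSucc]
      exact one_ne_zero (((pf_skewTridiagonal (n + 1)).symm.trans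
        (congrArg (pf (n + 1)) h2.symm)).trans h1))
  have h3 := congrArg (evalRingHom (0 : R)) key
  rw [RingHom.map_det, map_sub, map_mul, map_mul, ← pf_map, ← pf_map, ← pf_map, ← pf_map,
    border_map, border_map, border_map, border_map, ← submatrix_map, hK0] at h3
  have h4 : (evalRingHom (0 : R)).mapMatrix (consTwoCols (fun j => C (a j)) b' K') =
      consTwoCols a b K := by
    ext i j
    refine Fin.cases ?_ (fun j' => Fin.cases ?_ (fun w => ?_) j') j
    · simp [consTwoCols]
    · exact hb0 i
    · exact congrFun (congrFun hK0 i) w.castSucc.castSucc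
  simp only [h4, hb0] at h3
  simpa using h3

end PfaffianIdentities

section DesnanotJacobi

/-- The Desnanot–Jacobi identity, when one of the connected minors does not vanish. -/
theorem desnanot_jacobi_of_ne_zero {R : Type*} [CommRing R] [IsDomain R] {m : ℕ}
    (M : Matrix (Fin (m + 2)) (Fin (m + 2)) R)
    (h0 : M.adjugate (Fin.last _) (Fin.last _) ≠ 0) :
    M.adjugate 0 0 * M.adjugate (Fin.last _) (Fin.last _) -
      M.adjugate 0 (Fin.last _) * M.adjugate (Fin.last _) 0 =
    M.det * (M.submatrix (fun i : Fin m => i.succ.castSucc) (fun i => i.succ.castSucc)).det := by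
  -- `v` combines two rows of the adjugate so that its last component vanishes.
  set N := M.updateCol (Fin.last _) (Pi.single (Fin.last _) 1) with hN
  set v : Fin (m + 2) → R := M.adjugate (Fin.last _) (Fin.last _) • M.adjugate 0 -
    M.adjugate 0 (Fin.last _) • M.adjugate (Fin.last _) with hv
  have hrow : ∀ i j, (M.adjugate i ᵥ* M) j = if i = j then M.det else 0 := by
    intro i j
    have := congrFun (congrFun (adjugate_mul M) i) j
    simpa [Matrix.one_apply, mul_apply, vecMul, dotProduct] using this
  have hvN : v ᵥ* N = Pi.single 0 (M.adjugate (Fin.last _) (Fin.last _) * M.det) := by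
    ext j
    by_cases hj : j = Fin.last _
    · subst hj
      rw [Pi.single_eq_of_ne (by simp [Fin.ext_iff])]
      simp [hN, vecMul, hv]
      ring
    · have h1 : (v ᵥ* N) j = (v ᵥ* M) j := by
        simp [vecMul, hN, hj]
      rw [h1, hv, sub_vecMul, smul_vecMul, smul_vecMul, Pi.sub_apply, Pi.smul_apply, Pi.smul_apply,
        hrow, hrow, if_neg (Ne.symm hj)]
      by_cases h0 : j = 0
      · simp [h0]
      · simp [h0, Ne.symm h0]
  have h1 := det_mul_eq_of_vecMul_eq_single hvN 0
  have h2 : N.adjugate 0 0 =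
      (M.submatrix (fun i : Fin m => i.succ.castSucc) (fun i => i.succ.castSucc)).det := by
    rw [adjugate_fin_succ_eq_det_submatrix, det_succ_column _ (Fin.last _),
      Finset.sum_eq_single (Fin.last _)]
    · have h3 : ((N.submatrix (Fin.succAbove 0) (Fin.succAbove 0)).submatrix
          (Fin.succAbove (Fin.last m)) (Fin.succAbove (Fin.last m))) =
          M.submatrix (fun i : Fin m => i.succ.castSucc) (fun i => i.succ.castSucc) := by
        ext i j
        have : j.castSucc.succ ≠ Fin.last (m + 1) := by
          rw [ne_eq, Fin.ext_iff, Fin.val_succ, Fin.val_castSucc, Fin.val_last]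
          omega
        simp [hN, this]
      rw [h3]
      simp [hN, ← two_mul]
    · intro b _ hb
      have : b.succ ≠ Fin.last (m + 1) := fun h => hb (Fin.ext (by
        have := congrArg Fin.val h
        simpa using this))
      simp [hN, this]
    · simp
  rw [h2, ← adjugate_eq_det_updateCol] at h1
  refine mul_left_cancel₀ h0 ?_
  rw [← mul_assoc, ← h1, hv]
  simp only [Pi.sub_apply, Pi.smul_apply, smul_eq_mul]
  ring

open Polynomial in
/-- The Desnanot–Jacobi identity (Dodgson condensation), in terms of the adjugate. -/
theorem desnanot_jacobi {R : Type} [CommRing R] [IsDomain R] {m : ℕ}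
    (M : Matrix (Fin (m + 2)) (Fin (m + 2)) R) :
    M.adjugate 0 0 * M.adjugate (Fin.last _) (Fin.last _) -
      M.adjugate 0 (Fin.last _) * M.adjugate (Fin.last _) 0 =
    M.det * (M.submatrix (fun i : Fin m => i.succ.castSucc) (fun i => i.succ.castSucc)).det := by
  let B : Matrix (Fin (m + 2)) (Fin (m + 2)) R[X] := polySegment M 1
  have hB : ∀ (x : R) (i j), evalRingHom x (B.adjugate i j) =
      (B.map (evalRingHom x)).adjugate i j := fun x i j =>
    congrFun (congrFun (RingHom.map_adjugate (evalRingHom x) B) i) j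
  have key := desnanot_jacobi_of_ne_zero B (fun h => by
    have h1 := congrArg (evalRingHom (1 : R)) h
    rw [hB, polySegment_map_one, adjugate_one, map_zero] at h1
    simp at h1)
  have h3 := congrArg (evalRingHom (0 : R)) key
  rw [map_sub, map_mul, map_mul, map_mul, hB, hB, hB, hB, RingHom.map_det, RingHom.map_det,
    RingHom.mapMatrix_apply, RingHom.mapMatrix_apply, ← submatrix_map, polySegment_map_zero] at h3
  exact h3

end DesnanotJacobi

/-! ### Blocks of infinite matrices -/

section PfaffianComplex

theorem pfaffian_eq_pf {n : ℕ} (A : Matrix (Fin (2 * n)) (Fin (2 * n)) ℂ) :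
    pfaffian A = pf n A := by
  unfold pfaffian pf pfSum pfTerm
  rw [Algebra.smul_def, one_div]
  simp

end PfaffianComplex

section PfaffianSigns

variable {R : Type*} [CommRing R] [Algebra ℚ R]

theorem pf_neg (n : ℕ) (A : Matrix (Fin (2 * n)) (Fin (2 * n)) R) :
    pf n (-A) = (-1) ^ n * pf n A := by
  unfold pf pfSum pfTerm
  rw [mul_smul_comm, Finset.mul_sum]
  congr 1
  refine Finset.sum_congr rfl fun σ _ => ?_
  simp only [Matrix.neg_apply, Finset.prod_neg, Finset.card_univ, Fintype.card_fin]
  ring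

theorem pf_rev (n : ℕ) (A : Matrix (Fin (2 * n)) (Fin (2 * n)) R) :
    pf n (A.submatrix Fin.rev Fin.rev) = (-1) ^ n * pf n A := by
  -- The sign of the reversal is found from its effect on a matrix with nonzero Pfaffian.
  have hs : ((Equiv.Perm.sign (Fin.revPerm : Equiv.Perm (Fin (2 * n))) : ℤ) : R) = (-1) ^ n := by
    have h := pf_submatrix_perm n (skewTridiagonal R (2 * n)) Fin.revPerm
    have h2 : (skewTridiagonal R (2 * n)).submatrix Fin.revPerm Fin.revPerm =
        -skewTridiagonal R (2 * n) := by
      ext i j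
      have hi := i.2
      have hj := j.2
      simp only [skewTridiagonal, submatrix_apply, Fin.revPerm_apply, of_apply, Fin.val_rev,
        Matrix.neg_apply]
      split_ifs <;> first | omega | simp
    rw [h2, pf_neg, pf_skewTridiagonal] at h
    simpa using h.symm
  have h := pf_submatrix_perm n A Fin.revPerm
  rw [hs] at h
  exact h

theorem pf_border_one (a : Fin (2 * 0 + 1) → R)
    (K : Matrix (Fin (2 * 0 + 1)) (Fin (2 * 0 + 1)) R) (hK : ∀ i j, K i j = -K j i) :
    pf (0 + 1) (border a K) = a 0 := by
  rw [pf_border 0 a K hK, dotProduct]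
  refine (Fin.sum_univ_one _).trans ?_
  change pfVec 0 K 0 * a 0 = a 0
  rw [pfVec_zero, pf_zero, one_mul]

end PfaffianSigns

section PairFlip

/-- The permutation of `0, …, 2k - 1` that exchanges `2i` and `2i + 1` for all `i`. -/
def pairFlip (k : ℕ) : Equiv.Perm (Fin (2 * k)) :=
  (finProdFinEquiv.trans (finCongr (mul_comm k 2))).permCongr
    (Equiv.prodCongrRight fun _ : Fin k => Equiv.swap (0 : Fin 2) 1)

theorem sign_pairFlip (k : ℕ) : Equiv.Perm.sign (pairFlip k) = (-1) ^ k := by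
  rw [pairFlip, Equiv.Perm.sign_permCongr, Equiv.Perm.sign_prodCongrRight]
  simp

theorem val_pairFlip (k : ℕ) (i : Fin (2 * k)) :
    (pairFlip k i : ℕ) = if Even (i : ℕ) then (i : ℕ) + 1 else (i : ℕ) - 1 := by
  obtain ⟨⟨c, d⟩, rfl⟩ := (finProdFinEquiv.trans (finCongr (mul_comm k 2))).surjective i
  rw [pairFlip, Equiv.permCongr_apply, Equiv.symm_apply_apply]
  fin_cases d
  · simp [add_comm]
  · have h : ¬ Even (2 * (c : ℕ) + 1) := by simp
    simp [add_comm 1 (2 * (c : ℕ)), h]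

theorem det_submatrix_pairFlip {R : Type*} [CommRing R] (k : ℕ)
    (A : Matrix (Fin (2 * k)) (Fin (2 * k)) R) :
    (A.submatrix (pairFlip k) id).det = (-1) ^ k * A.det := by
  rw [det_permute, sign_pairFlip]
  simp

end PairFlip

section Window

variable {R : Type*}

/-- The `n × n` block of an infinite matrix with upper left corner in place `(s, t)`. -/
def window (F : Matrix ℤ ℤ R) (s t : ℤ) (n : ℕ) : Matrix (Fin n) (Fin n) R :=
  of fun p q => F (s + (p : ℤ)) (t + (q : ℤ))

theorem window_congr {F G : Matrix ℤ ℤ R} {s t s' t' : ℤ} {n : ℕ}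
    (h : ∀ p q : ℕ, p < n → q < n → F (s + p) (t + q) = G (s' + p) (t' + q)) :
    window F s t n = window G s' t' n := by
  ext p q
  exact h p q p.2 q.2

theorem window_submatrix_castSucc (F : Matrix ℤ ℤ R) (s t : ℤ) (n : ℕ) :
    (window F s t (n + 1)).submatrix Fin.castSucc Fin.castSucc = window F s t n := rfl

theorem window_submatrix_succ (F : Matrix ℤ ℤ R) (s t : ℤ) (n : ℕ) :
    (window F s t (n + 1)).submatrix Fin.succ Fin.succ = window F (s + 1) (t + 1) n := by
  ext p q
  simp [window, add_assoc, add_comm (1 : ℤ)]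

theorem window_submatrix_castSucc_succ (F : Matrix ℤ ℤ R) (s t : ℤ) (n : ℕ) :
    (window F s t (n + 1)).submatrix Fin.castSucc Fin.succ = window F s (t + 1) n := by
  ext p q
  simp [window, add_assoc, add_comm (1 : ℤ)]

theorem window_submatrix_succ_castSucc (F : Matrix ℤ ℤ R) (s t : ℤ) (n : ℕ) :
    (window F s t (n + 1)).submatrix Fin.succ Fin.castSucc = window F (s + 1) t n := by
  ext p q
  simp [window, add_assoc, add_comm (1 : ℤ)]

variable [CommRing R]

theorem det_window_of_last_row (F : Matrix ℤ ℤ R) (s t : ℤ) (n : ℕ)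
    (h1 : F (s + n) (t + n) = 1) (h0 : ∀ q : ℕ, q < n → F (s + n) (t + q) = 0) :
    (window F s t (n + 1)).det = (window F s t n).det := by
  rw [det_succ_row _ (Fin.last n), Finset.sum_eq_single (Fin.last n)]
  · rw [Fin.succAbove_last, window_submatrix_castSucc]
    simp [window, h1, ← two_mul]
  · intro b _ hb
    have : window F s t (n + 1) (Fin.last n) b = 0 :=
      h0 b (lt_of_le_of_ne (Nat.le_of_lt_succ b.2) fun h => hb (Fin.ext h))
    simp [this]
  · simp

theorem det_window_of_first_col (F : Matrix ℤ ℤ R) (s t : ℤ) (n : ℕ)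
    (h1 : F s t = 1) (h0 : ∀ p : ℕ, 0 < p → p ≤ n → F (s + p) t = 0) :
    (window F s t (n + 1)).det = (window F (s + 1) (t + 1) n).det := by
  rw [det_succ_column_zero, Finset.sum_eq_single 0]
  · rw [Fin.succAbove_zero, window_submatrix_succ]
    simp [window, h1]
  · intro b _ hb
    have : window F s t (n + 1) b 0 = 0 := by
      have := h0 b (Nat.pos_of_ne_zero fun h => hb (Fin.ext h)) (Nat.le_of_lt_succ b.2)
      simpa [window] using this
    simp [this]
  · simp

/-- Dodgson condensation for the blocks of an infinite matrix. -/
theorem window_desnanot_jacobi {R : Type} [CommRing R] [IsDomain R] (F : Matrix ℤ ℤ R) (s t : ℤ)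
    (m : ℕ) :
    (window F s t (m + 1)).det * (window F (s + 1) (t + 1) (m + 1)).det -
      (window F s t (m + 2)).det * (window F (s + 1) (t + 1) m).det =
    (window F (s + 1) t (m + 1)).det * (window F s (t + 1) (m + 1)).det := by
  have h := desnanot_jacobi (window F s t (m + 2))
  simp only [adjugate_fin_succ_eq_det_submatrix, Fin.succAbove_zero, Fin.succAbove_last,
    window_submatrix_succ, window_submatrix_castSucc, window_submatrix_castSucc_succ,
    window_submatrix_succ_castSucc] at h
  have hin : (window F s t (m + 2)).submatrix (fun i : Fin m => i.succ.castSucc)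
      (fun i => i.succ.castSucc) = window F (s + 1) (t + 1) m :=
    window_submatrix_succ F s t m
  rw [hin] at h
  have hsgn : ((-1 : R) ^ (m + 1)) * (-1) ^ (m + 1) = 1 := by
    rw [← mul_pow]
    simp
  have hsgn2 : ((-1 : R) ^ (m + 1 + (m + 1))) = 1 := by
    rw [pow_add, hsgn]
  simp only [Fin.val_last, Fin.val_zero, add_zero, zero_add, pow_zero, one_mul, hsgn2] at h
  linear_combination h + (window F (s + 1) t (m + 1)).det * (window F s (t + 1) (m + 1)).det * hsgn

end Window

theorem skipPerm_one_zero (m : ℕ) : skipPerm (1 : Fin (m + 2)) 0 = 0 := by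
  simp [skipPerm]

theorem skipPerm_one_succ (m : ℕ) (x : Fin m) :
    skipPerm (1 : Fin (m + 2)) x.succ = x.succ.succ := by
  rw [skipPerm, Equiv.swap_apply_of_ne_of_ne (Fin.succ_ne_zero _)]
  simp [Fin.ext_iff]

section SkewWindow

variable {R : Type} [CommRing R] [IsDomain R] [Algebra ℚ R] {S : Matrix ℤ ℤ R}

theorem window_succ_eq_border (hS : ∀ i j, S i j = -S j i) (s : ℤ) (m : ℕ) :
    window S s s (m + 1) =
      border (fun j : Fin m => S s (s + 1 + (j : ℤ))) (window S (s + 1) (s + 1) m) := by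
  have : CharZero R := algebraRat.charZero R
  rw [eq_border (window S s s (m + 1)) (fun i j => hS _ _) (self_eq_neg.mp (hS _ _)),
    window_submatrix_succ]
  congr 1
  funext j
  simp [window, add_assoc, add_comm (1 : ℤ)]

/-- `det_castSucc_succ_eq_pf_mul_pf` for the blocks of an infinite matrix. -/
theorem det_window_eq_pf_mul_pf (hS : ∀ i j, S i j = -S j i) (s : ℤ) (n : ℕ) :
    (window S (s + 1) s (2 * n)).det =
      pf n (window S s s (2 * n)) * pf n (window S (s + 1) (s + 1) (2 * n)) := by
  have h := det_castSucc_succ_eq_pf_mul_pf (window S s s (2 * n + 1)) (fun i j => hS _ _)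
  rwa [window_submatrix_succ_castSucc, window_submatrix_castSucc, window_submatrix_succ] at h

theorem pf_window_two (hS : ∀ i j, S i j = -S j i) (s : ℤ) :
    pf (0 + 1) (window S s s (2 * (0 + 1))) = S s (s + 1) := by
  refine (congrArg (pf (0 + 1)) (window_succ_eq_border hS s (2 * 0 + 1))).trans ?_
  refine (pf_border_one _ _ fun i j => hS _ _).trans ?_
  simp

/-- Expansion of a Pfaffian along a first row with only two nonzero entries. -/
theorem pf_window_of_short_row (hS : ∀ i j, S i j = -S j i) (n : ℕ)
    (h0 : ∀ j, 3 ≤ j → S 0 j = 0) :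
    pf (n + 2) (window S 0 0 (2 * (n + 2))) =
      S 0 1 * pf (n + 1) (window S 2 2 (2 * (n + 1))) -
      S 0 2 * pf (n + 1) (border (m := 2 * n + 1) (fun j : Fin (2 * n + 1) => S 1 (3 + (j : ℤ)))
        (window S 3 3 (2 * n + 1))) := by
  have : CharZero R := algebraRat.charZero R
  have hb : pf (n + 2) (window S 0 0 (2 * (n + 2))) =
      pf (n + 2) (border (m := 2 * (n + 1) + 1) (fun j : Fin (2 * (n + 1) + 1) =>
        S 0 (1 + (j : ℤ))) (window S 1 1 (2 * (n + 1) + 1))) :=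
    congrArg (pf (n + 2)) (window_succ_eq_border hS 0 (2 * (n + 1) + 1))
  rw [hb]
  refine (pf_border (n + 1) (fun j : Fin (2 * (n + 1) + 1) => S 0 (1 + (j : ℤ)))
    (window S 1 1 (2 * (n + 1) + 1)) (fun i j => hS _ _)).trans ?_
  rw [dotProduct, Fin.sum_univ_succ]
  have h2 := Fin.sum_univ_succ (n := 2 * n + 1) (fun i : Fin (2 * n + 1 + 1) =>
    pfVec (n + 1) (window S 1 1 (2 * (n + 1) + 1)) i.succ *
      S 0 (1 + ((i.succ : Fin (2 * n + 1 + 1 + 1)) : ℤ)))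
  refine (congrArg₂ (· + ·) rfl h2).trans ?_
  rw [Finset.sum_eq_zero]
  · rw [pfVec_zero, window_submatrix_succ]
    have h3 : pfVec (n + 1) (window S 1 1 (2 * (n + 1) + 1)) (Fin.succ (0 : Fin (2 * n + 1 + 1))) =
        -pf (n + 1) (border (m := 2 * n + 1) (fun j : Fin (2 * n + 1) => S 1 (3 + (j : ℤ)))
        (window S 3 3 (2 * n + 1))) := by
      have h4 : (window S 1 1 (2 * n + 1 + 1 + 1)).submatrix
          (skipPerm (Fin.succ (0 : Fin (2 * n + 1 + 1))))
          (skipPerm (Fin.succ (0 : Fin (2 * n + 1 + 1)))) =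
          border (m := 2 * n + 1) (fun j : Fin (2 * n + 1) => S 1 (3 + (j : ℤ)))
            (window S 3 3 (2 * n + 1)) := by
        have h00 : S 1 1 = 0 := self_eq_neg.mp (hS 1 1)
        ext i j
        refine Fin.cases ?_ (fun i' => ?_) i <;> refine Fin.cases ?_ (fun j' => ?_) j
        · simpa [skipPerm_one_zero, window] using h00
        · simp [skipPerm_one_zero, skipPerm_one_succ, window]
          congr 1
          ring
        · simp [skipPerm_one_zero, skipPerm_one_succ, window]
          rw [hS]
          congr 2
          ring
        · simp [skipPerm_one_succ, window]
          congr 1 <;> ring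
      rw [pfVec, if_neg (Fin.succ_ne_zero _), neg_one_mul]
      exact congrArg (fun M => -pf (n + 1) M) h4
    refine (congrArg₂ (· + ·) rfl (congrArg₂ (· + ·) (congrArg₂ (· * ·) h3 rfl) rfl)).trans ?_
    simp
    ring
  · intro i _
    rw [h0, mul_zero]
    simp only [Fin.val_succ, Nat.cast_add, Nat.cast_one]
    omega

/-- The quadratic identity for the Pfaffians of the blocks of a skew-symmetric matrix whose first
row has only two nonzero entries. -/
theorem pf_window_quadratic (hS : ∀ i j, S i j = -S j i) (h0 : ∀ j, 3 ≤ j → S 0 j = 0) (n : ℕ) :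
    pf (n + 1) (window S 0 0 (2 * (n + 1))) * pf (n + 1) (window S 2 2 (2 * (n + 1))) -
      pf (n + 2) (window S 0 0 (2 * (n + 2))) * pf n (window S 2 2 (2 * n)) =
    -(S 0 2 * (window S 3 1 (2 * n + 1)).det) := by
  have hpf2 : ∀ n, pf (n + 1) (window S 2 2 (2 * (n + 1))) =
      pf (n + 1) (border (m := 2 * n + 1) (fun j : Fin (2 * n + 1) => S 2 (3 + (j : ℤ)))
        (window S 3 3 (2 * n + 1))) := fun n =>
    congrArg (pf (n + 1)) (window_succ_eq_border hS 2 (2 * n + 1))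
  cases n with
  | zero =>
    have h2 : pf (0 + 1) (border (m := 2 * 0 + 1) (fun j : Fin (2 * 0 + 1) => S 1 (3 + (j : ℤ)))
        (window S 3 3 (2 * 0 + 1))) = S 1 3 := by
      refine (pf_border_one _ _ fun i j => hS _ _).trans ?_
      simp
    have h3 : (window S 3 1 (2 * 0 + 1)).det = S 3 1 := by
      refine (det_fin_one _).trans ?_
      simp [window]
    rw [pf_window_of_short_row hS 0 h0, pf_window_two hS, pf_window_two hS, h2, h3, hS 3 1, pf_zero]
    norm_num
  | succ n =>
    have key := det_consTwoCols (n := n) (fun j => S 1 (3 + (j : ℤ))) (fun j => S 2 (3 + (j : ℤ)))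
      (window S 3 3 (2 * n + 1 + 2)) (fun i j => hS _ _)
    have hdet : (consTwoCols (fun j => S 1 (3 + (j : ℤ))) (fun j => S 2 (3 + (j : ℤ)))
        (window S 3 3 (2 * n + 1 + 2))).det = (window S 3 1 (2 * n + 1 + 2)).det := by
      let c : Fin (2 * n + 1 + 2) → R := Fin.cons (-1) (Fin.cons (-1) fun _ => 1)
      have h : consTwoCols (fun j => S 1 (3 + (j : ℤ))) (fun j => S 2 (3 + (j : ℤ)))
          (window S 3 3 (2 * n + 1 + 2)) =
          of fun i j => c j * window S 3 1 (2 * n + 1 + 2) i j := by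
        ext i j
        refine Fin.cases ?_ (fun j' => Fin.cases ?_ (fun w => ?_) j') j
        · simpa [consTwoCols, window, c] using hS _ _
        · simpa [consTwoCols, window, c] using hS _ _
        · simp [consTwoCols, window, c]
          congr 1
          ring
      rw [h, det_mul_row]
      simp [c, Fin.prod_univ_succ]
    rw [hdet] at key
    rw [pf_window_of_short_row hS n h0, pf_window_of_short_row hS (n + 1) h0, hpf2, hpf2]
    have key' : (window S 3 1 (2 * (n + 1) + 1)).det =
        pf (n + 1) (border (m := 2 * n + 1) (fun j : Fin (2 * n + 1) => S 1 (3 + (j : ℤ)))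
          (window S 3 3 (2 * n + 1))) *
        pf (n + 1 + 1) (border (m := 2 * (n + 1) + 1) (fun j : Fin (2 * (n + 1) + 1) =>
          S 2 (3 + (j : ℤ))) (window S 3 3 (2 * (n + 1) + 1))) -
        pf (n + 1) (border (m := 2 * n + 1) (fun j : Fin (2 * n + 1) => S 2 (3 + (j : ℤ)))
          (window S 3 3 (2 * n + 1))) *
        pf (n + 1 + 1) (border (m := 2 * (n + 1) + 1) (fun j : Fin (2 * (n + 1) + 1) =>
          S 1 (3 + (j : ℤ))) (window S 3 3 (2 * (n + 1) + 1))) := key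
    linear_combination S 0 2 * key'

end SkewWindow

/-! ### The infinite matrices of the Toda equations -/

section InfiniteMatrices

theorem shiftVar_shiftVar (a b : ℤ) (x : ℕ → ℤ → ℂ) :
    shiftVar a (shiftVar b x) = shiftVar (a + b) x := by
  funext i l
  simp [shiftVar, add_assoc]

theorem calT_of_even (r : ℕ) (x : ℕ → ℤ → ℂ) {i : ℤ} (hi : Even i) (j : ℤ) : calT r x i j = 0 := by
  have : ¬ Odd i := Int.not_odd_iff_even.mpr hi
  simp [calT, this]

theorem calE_of_odd (r : ℕ) (x : ℕ → ℤ → ℂ) {i : ℤ} (hi : Odd i) (j : ℤ) : calE r x i j = 0 := by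
  have : ¬ Even i := Int.not_even_iff_odd.mpr hi
  simp [calE, this]

theorem calT_shift_congr (r : ℕ) (x : ℕ → ℤ → ℂ) {ξ ξ' i i' j j' : ℤ} (h : ξ = ξ') (hi : i = i')
    (hj : j = j') : calT r (shiftVar ξ x) i j = calT r (shiftVar ξ' x) i' j' := by
  rw [h, hi, hj]

theorem calE_shift_congr (r : ℕ) (x : ℕ → ℤ → ℂ) {ξ ξ' i i' j j' : ℤ} (h : ξ = ξ') (hi : i = i')
    (hj : j = j') : calE r (shiftVar ξ x) i j = calE r (shiftVar ξ' x) i' j' := by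
  rw [h, hi, hj]

/-- The infinite matrix whose diagonal blocks are, up to a shift, the matrices of the determinants
`T_k^a` with `a ≤ r - 2`. -/
def vectorInf (r : ℕ) (x : ℕ → ℤ → ℂ) (a : ℤ) : Matrix ℤ ℤ ℂ := of fun p q =>
  calT r (shiftVar (1 - a) x) (1 + p) (2 * a - 1 + q) +
    calE r (shiftVar (5 - (r : ℤ) + a) x) (p - 1) (q - 1)

/-- The infinite skew-symmetric matrix whose diagonal blocks are, up to a shift, the matrices of the
Pfaffians `T_k^{r-1}` and `T_k^r`. -/
def spinorInf (r : ℕ) (x : ℕ → ℤ → ℂ) : Matrix ℤ ℤ ℂ := of fun i j =>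
  calT r (shiftVar (3 - (r : ℤ)) x) i (2 * (r : ℤ) - 4 + j) + calE r (shiftVar 1 x) i (j + 2)

theorem vectorMatrix_eq_window (r : ℕ) (x : ℕ → ℤ → ℂ) (k a : ℕ) :
    vectorMatrix r x k a = window (vectorInf r (shiftVar (1 - (k : ℤ)) x) a) 0 0 (2 * k - 1) := by
  ext p q
  simp only [vectorMatrix, subT, subELast, block, window, vectorInf, Matrix.add_apply, of_apply,
    shiftVar_shiftVar]
  exact congrArg₂ (· + ·) (calT_shift_congr r x (by ring) (by ring) (by ring))
    (calE_shift_congr r x (by ring) (by ring) (by ring))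

theorem spinorMatrixPred_eq_window (r : ℕ) (x : ℕ → ℤ → ℂ) (k : ℕ) :
    spinorMatrixPred r x k = window (spinorInf r (shiftVar (-(k : ℤ)) x)) 0 0 (2 * k) := by
  ext p q
  simp only [spinorMatrixPred, subTPred, subEPred, block, window, spinorInf, Matrix.add_apply,
    of_apply, shiftVar_shiftVar]
  exact congrArg₂ (· + ·) (calT_shift_congr r x (by ring) (by ring) (by ring))
    (calE_shift_congr r x (by ring) (by ring) (by ring))

theorem spinorMatrixLast_eq_window (r : ℕ) (x : ℕ → ℤ → ℂ) (k : ℕ) :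
    spinorMatrixLast r x k = window (spinorInf r (shiftVar (-(k : ℤ)) x)) 1 1 (2 * k) := by
  ext p q
  simp only [spinorMatrixLast, subTLast, subELast, block, window, spinorInf, Matrix.add_apply,
    of_apply, shiftVar_shiftVar]
  have h := calE_add_two r (shiftVar (1 + -(k : ℤ)) x) ((p : ℤ) - 1) ((q : ℤ) + 1)
  rw [shiftVar_shiftVar] at h
  exact congrArg₂ (· + ·) (calT_shift_congr r x (by ring) (by ring) (by ring))
    ((calE_shift_congr r x (by ring) (by ring) (by ring)).trans (h.symm.trans
      (calE_shift_congr r x (by ring) (by ring) (by ring))))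

variable (r : ℕ) (x : ℕ → ℤ → ℂ)

theorem vectorInf_add_two (a p q : ℤ) :
    vectorInf r x a (p + 2) (q + 2) = vectorInf r (shiftVar 2 x) a p q := by
  simp only [vectorInf, of_apply]
  have h1 : shiftVar (1 - a) (shiftVar 2 x) = shiftVar 2 (shiftVar (1 - a) x) := by
    rw [shiftVar_shiftVar, shiftVar_shiftVar, add_comm]
  have h2 : shiftVar (5 - (r : ℤ) + a) (shiftVar 2 x) =
      shiftVar 2 (shiftVar (5 - (r : ℤ) + a) x) := by
    rw [shiftVar_shiftVar, shiftVar_shiftVar, add_comm]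
  rw [h1, h2, ← calT_add_two, ← calE_add_two]
  congr 2 <;> ring

theorem spinorInf_add_two (i j : ℤ) :
    spinorInf r x (i + 2) (j + 2) = spinorInf r (shiftVar 2 x) i j := by
  simp only [spinorInf, of_apply]
  have h1 : shiftVar (3 - (r : ℤ)) (shiftVar 2 x) = shiftVar 2 (shiftVar (3 - (r : ℤ)) x) := by
    rw [shiftVar_shiftVar, shiftVar_shiftVar, add_comm]
  have h2 : shiftVar 1 (shiftVar 2 x) = shiftVar 2 (shiftVar 1 x) := by
    rw [shiftVar_shiftVar, shiftVar_shiftVar, add_comm]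
  rw [h1, h2, ← calT_add_two, ← calE_add_two]
  congr 2
  ring

theorem vectorInf_of_odd {p : ℤ} (hp : Odd p) (a q : ℤ) :
    vectorInf r x a p q = calE r (shiftVar (5 - (r : ℤ) + a) x) (p - 1) (q - 1) := by
  have : Even (1 + p) := odd_one.add_odd hp
  rw [vectorInf, of_apply, calT_of_even _ _ this, zero_add]

theorem vectorInf_of_even {p : ℤ} (hp : Even p) (a q : ℤ) :
    vectorInf r x a p q = calT r (shiftVar (1 - a) x) (1 + p) (2 * a - 1 + q) := by
  have : Odd (p - 1) := hp.sub_odd odd_one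
  rw [vectorInf, of_apply, calE_of_odd _ _ this, add_zero]

theorem vectorInf_odd_self {p : ℤ} (hp : Odd p) (a : ℤ) : vectorInf r x a p p = 1 := by
  have : Even (p - 1) := hp.sub_odd odd_one
  simp [vectorInf_of_odd r x hp, calE, this]

theorem vectorInf_odd_of_lt {p q : ℤ} (hp : Odd p) (a : ℤ) (h : q < p) :
    vectorInf r x a p q = 0 := by
  rw [vectorInf_of_odd r x hp, calE, of_apply, if_neg, if_neg, if_neg, if_neg] <;>
    rintro ⟨_, h2⟩ <;> omega

theorem vectorInf_even_odd_of_lt {p q a : ℤ} (hp : Even p) (hq : Odd q)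
    (h : q < p + (2 * r - 3 - 2 * a)) : vectorInf r x a p q = 0 := by
  have ho : ¬ Even (1 + p - (2 * a - 1 + q)) := by
    rw [Int.even_iff]
    rw [Int.even_iff] at hp
    rw [Int.odd_iff] at hq
    omega
  rw [vectorInf_of_even r x hp, calT, of_apply, if_neg, if_neg, if_neg, if_neg]
  · exact fun h => ho h.2.1
  · rintro ⟨_, h2⟩
    omega
  · rintro ⟨_, h2⟩
    omega
  · exact fun h => ho h.2.1

/-- The blocks for `a + 1` are rearranged blocks for `a`: rows of `𝒯` and rows of `ℰ` move by
different amounts. -/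
theorem vectorInf_add_one_of_even {p : ℤ} (hp : Even p) (a q : ℤ) :
    vectorInf r (shiftVar 1 x) (a + 1) p q = vectorInf r x a p (q + 2) := by
  rw [vectorInf_of_even r _ hp, vectorInf_of_even r _ hp, shiftVar_shiftVar]
  exact calT_shift_congr r x (by ring) (by ring) (by ring)

theorem vectorInf_add_one_of_odd {p : ℤ} (hp : Odd p) (a q : ℤ) :
    vectorInf r (shiftVar 1 x) (a + 1) p q = vectorInf r x a (p + 2) (q + 2) := by
  rw [vectorInf_add_two, vectorInf_of_odd r _ hp, vectorInf_of_odd r _ hp, shiftVar_shiftVar,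
    shiftVar_shiftVar]
  congr 2
  ring

theorem vectorInf_sub_one_of_even {p : ℤ} (hp : Even p) (a q : ℤ) :
    vectorInf r (shiftVar 1 x) (a - 1) p q = vectorInf r x a (p + 2) q := by
  rw [vectorInf_of_even r _ hp, vectorInf_of_even r _ (hp.add even_two), shiftVar_shiftVar]
  have h := calT_add_two r (shiftVar (1 - a) x) (1 + p) (2 * (a - 1) - 1 + q)
  rw [shiftVar_shiftVar] at h
  exact (calT_shift_congr r x (by ring) (by ring) (by ring)).trans
    (h.symm.trans (calT_shift_congr r x (by ring) (by ring) (by ring)))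

theorem vectorInf_sub_one_of_odd {p : ℤ} (hp : Odd p) (a q : ℤ) :
    vectorInf r (shiftVar 1 x) (a - 1) p q = vectorInf r x a p q := by
  rw [vectorInf_of_odd r _ hp, vectorInf_of_odd r _ hp, shiftVar_shiftVar]
  congr 2
  ring

/-- For `a = r - 2` the rows of both kinds fit together to the skew-symmetric matrix. -/
theorem vectorInf_sub_two (p q : ℤ) :
    vectorInf r x ((r : ℤ) - 2) p q = spinorInf r x (p + 1) (q - 1) := by
  have h := calE_add_two r (shiftVar 1 x) (p - 1) (q - 1)
  rw [shiftVar_shiftVar] at h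
  simp only [vectorInf, spinorInf, of_apply]
  exact congrArg₂ (· + ·) (calT_shift_congr r x (by ring) (by ring) (by ring))
    ((calE_shift_congr r x (by ring) (by ring) (by ring)).trans (h.symm.trans
      (calE_shift_congr r x (by ring) (by ring) (by ring))))

theorem vectorInf_zero_even_self (hx : ∀ l, x 0 l = 1) (hr : 4 ≤ r) {p : ℤ} (hp : Even p) :
    vectorInf r x 0 p p = 1 := by
  rw [vectorInf_of_even r x hp, calT, of_apply, if_pos]
  · have : ((2 * 0 - 1 + p - (1 + p)) / 2 + 1).toNat = 0 := by omega
    rw [this]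
    exact hx _
  · refine ⟨odd_one.add_even hp, ⟨1, by ring⟩, by omega, by omega⟩

theorem vectorInf_zero_even_of_lt (hr : 4 ≤ r) {p q : ℤ} (hp : Even p) (h : q < p) :
    vectorInf r x 0 p q = 0 := by
  rw [vectorInf_of_even r x hp, calT, of_apply, if_neg, if_neg, if_neg, if_neg]
  · rintro ⟨_, _, _, _⟩
    omega
  · rintro ⟨_, _⟩
    omega
  · rintro ⟨_, _⟩
    omega
  · rintro ⟨_, ⟨_, _⟩, _, _⟩
    omega

theorem spinorInf_even_sub_two {i : ℤ} (hi : Even i) : spinorInf r x i (i - 2) = 1 := by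
  simp [spinorInf, calT_of_even _ _ hi, calE, hi]

theorem spinorInf_even_of_lt {i j : ℤ} (hi : Even i) (h : j < i - 2) : spinorInf r x i j = 0 := by
  rw [spinorInf, of_apply, calT_of_even _ _ hi, zero_add, calE, of_apply, if_neg, if_neg, if_neg,
    if_neg] <;> rintro ⟨_, h2⟩ <;> omega

theorem spinorInf_even_add_two {i : ℤ} (hi : Even i) : spinorInf r x i (i + 2) = -1 := by
  have h : i + 2 + 2 - 4 = i := by ring
  have h2 : i ≠ i + 2 + 2 := by omega
  simp only [spinorInf, of_apply, calT_of_even _ _ hi, calE, hi, h, h2]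
  simp

theorem spinorInf_even_of_gt {i j : ℤ} (hi : Even i) (h : i + 2 < j) : spinorInf r x i j = 0 := by
  rw [spinorInf, of_apply, calT_of_even _ _ hi, zero_add, calE, of_apply, if_neg, if_neg, if_neg,
    if_neg] <;> rintro ⟨_, h2⟩ <;> omega

theorem spinorInf_skew_even_odd {i j : ℤ} (hi : Even i) (hj : Odd j) :
    spinorInf r x i j = -spinorInf r x j i := by
  have hd : ¬ Even (j - (2 * (r : ℤ) - 4 + i)) := by
    rw [Int.even_iff] at hi
    rw [Int.odd_iff] at hj
    rw [Int.even_iff]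
    omega
  rw [spinorInf, of_apply, of_apply, calT_of_even _ _ hi, calE_of_odd _ _ hj, zero_add, add_zero]
  simp only [of_apply, calT, calE, hi, hj, hd, true_and, false_and, and_false, if_false, shiftVar]
  rw [Int.even_iff] at hi
  rw [Int.odd_iff] at hj
  split_ifs <;> try omega
  · have : i + 1 = (j + (2 * (r : ℤ) - 4 + i) - 1) / 2 + (3 - r) := by omega
    simp [this]
  · have : i - 2 + 1 = (j + (2 * (r : ℤ) - 4 + i) - 3) / 2 + (3 - r) := by omega
    simp [this]
  · simp

theorem spinorInf_skew (hr : 4 ≤ r) (i j : ℤ) : spinorInf r x i j = -spinorInf r x j i := by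
  rcases Int.even_or_odd i with hi | hi <;> rcases Int.even_or_odd j with hj | hj
  · simp only [spinorInf, of_apply, calT_of_even _ _ hi, calT_of_even _ _ hj, calE, hi, hj,
      true_and]
    rw [Int.even_iff] at hi hj
    split_ifs <;> first | omega | simp
  · exact spinorInf_skew_even_odd r x hi hj
  · rw [spinorInf_skew_even_odd r x hj hi, neg_neg]
  · have hd : Even (i - (2 * (r : ℤ) - 4 + j)) := by
      rw [Int.odd_iff] at hi hj
      rw [Int.even_iff]
      omega
    have hd' : Even (j - (2 * (r : ℤ) - 4 + i)) := by
      rw [Int.odd_iff] at hi hj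
      rw [Int.even_iff]
      omega
    rw [spinorInf, of_apply, of_apply, calE_of_odd _ _ hi, calE_of_odd _ _ hj, add_zero, add_zero]
    simp only [of_apply, calT, hi, hj, hd, hd', true_and, shiftVar]
    rw [Int.odd_iff] at hi hj
    have e1 : (2 * (r : ℤ) - 4 + j - i) / 2 + 1 =
        (j - (2 * (r : ℤ) - 4 + i)) / 2 + 2 * (r : ℤ) - 3 := by omega
    have e2 : (2 * (r : ℤ) - 4 + i - j) / 2 + 1 =
        (i - (2 * (r : ℤ) - 4 + j)) / 2 + 2 * (r : ℤ) - 3 := by omega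
    have e3 : i + (2 * (r : ℤ) - 4 + j) = j + (2 * (r : ℤ) - 4 + i) := by ring
    split_ifs <;> try omega
    · rw [neg_neg, e1, e3]
    · rw [e2, e3]
    · rw [neg_zero]

end InfiniteMatrices

/-! ### Minors and Pfaffians of the Toda matrices -/

section VectorDeterminants

variable (r : ℕ) (x : ℕ → ℤ → ℂ) (a : ℤ)

theorem det_window_vectorInf_zero (m : ℕ) :
    (window (vectorInf r x a) 0 0 (2 * m + 1 + 1)).det =
      (window (vectorInf r x a) 0 0 (2 * m + 1)).det := by
  have ho : Odd ((0 : ℤ) + ((2 * m + 1 : ℕ) : ℤ)) := ⟨m, by push_cast; ring⟩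
  refine det_window_of_last_row _ _ _ _ (vectorInf_odd_self r x ho a) fun q hq =>
    vectorInf_odd_of_lt r x ho a (by omega)

theorem det_window_vectorInf_one (har : a ≤ (r : ℤ) - 2) (n : ℕ) :
    (window (vectorInf r x a) 1 1 (n + 1)).det = (window (vectorInf r x a) 2 2 n).det := by
  refine det_window_of_first_col _ _ _ _ (vectorInf_odd_self r x odd_one a) fun p hp _ => ?_
  rcases Int.even_or_odd (1 + (p : ℤ)) with h | h
  · exact vectorInf_even_odd_of_lt r x h odd_one (by omega)
  · exact vectorInf_odd_of_lt r x h a (by omega)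

theorem det_window_vectorInf_one_odd (har : a ≤ (r : ℤ) - 2) (m : ℕ) :
    (window (vectorInf r x a) 1 1 (2 * m + 1)).det =
      (window (vectorInf r x a) 2 2 (2 * m - 1)).det := by
  cases m with
  | zero => exact det_window_vectorInf_one r x a har 0
  | succ m =>
    have ho : Odd ((1 : ℤ) + ((2 * (m + 1) : ℕ) : ℤ)) := ⟨m + 1, by push_cast; ring⟩
    rw [det_window_of_last_row _ _ _ _ (vectorInf_odd_self r x ho a) fun q hq =>
      vectorInf_odd_of_lt r x ho a (by omega)]
    exact det_window_vectorInf_one r x a har (2 * m + 1)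

/-- The minor without the first row and the last column belongs to `a - 1`. -/
theorem det_window_vectorInf_one_zero (m : ℕ) :
    (window (vectorInf r x a) 1 0 (2 * m + 1 + 1)).det =
      (-1) ^ (m + 1) * (window (vectorInf r (shiftVar 1 x) (a - 1)) 0 0 (2 * m + 1)).det := by
  rw [← det_window_vectorInf_zero]
  have h := det_submatrix_pairFlip (m + 1) (window (vectorInf r (shiftVar 1 x) (a - 1)) 0 0
    (2 * (m + 1)))
  refine Eq.trans (congrArg det ?_) h
  ext i j
  change vectorInf r x a (1 + (i : ℕ)) (0 + (j : ℕ)) = vectorInf r (shiftVar 1 x) (a - 1)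
    (0 + (pairFlip (m + 1) i : ℕ)) (0 + (j : ℕ))
  have hp := val_pairFlip (m + 1) i
  rcases Nat.even_or_odd (i : ℕ) with hi | hi
  · have ho : Odd (0 + ((i : ℕ) + 1 : ℤ)) := by
      rw [zero_add]
      exact ((Int.even_coe_nat _).mpr hi).add_one
    rw [if_pos hi] at hp
    rw [hp, Nat.cast_add, Nat.cast_one, vectorInf_sub_one_of_odd r x ho]
    congr 1
    ring
  · have he : Even (0 + (((i : ℕ) - 1 : ℕ) : ℤ)) := by
      rw [zero_add]
      exact (Int.even_coe_nat _).mpr (Nat.Odd.sub_odd hi odd_one)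
    rw [if_neg (Nat.not_even_iff_odd.mpr hi)] at hp
    rw [hp, vectorInf_sub_one_of_even r x he]
    congr 1
    have := hi.pos
    omega

/-- The minor without the last row and the first column belongs to `a + 1`. -/
theorem det_window_vectorInf_zero_one (har : a ≤ (r : ℤ) - 3) (m : ℕ) :
    (window (vectorInf r x a) 0 1 (2 * m + 1 + 1)).det =
      (-1) ^ (m + 1) * (window (vectorInf r (shiftVar 1 x) (a + 1)) 0 0 (2 * m + 1)).det := by
  have ho : Odd (-1 : ℤ) := by decide
  have hc : (window (vectorInf r (shiftVar 1 x) (a + 1)) (-1) (-1) (2 * m + 1 + 1)).det =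
      (window (vectorInf r (shiftVar 1 x) (a + 1)) 0 0 (2 * m + 1)).det := by
    refine det_window_of_first_col _ _ _ _ (vectorInf_odd_self r _ ho _) fun p hp _ => ?_
    rcases Int.even_or_odd (-1 + (p : ℤ)) with h | h
    · exact vectorInf_even_odd_of_lt r _ h ho (by omega)
    · exact vectorInf_odd_of_lt r _ h _ (by omega)
  rw [← hc]
  have h := det_submatrix_pairFlip (m + 1) (window (vectorInf r (shiftVar 1 x) (a + 1)) (-1) (-1)
    (2 * (m + 1)))
  refine Eq.trans (congrArg det ?_) h
  ext i j
  change vectorInf r x a (0 + (i : ℕ)) (1 + (j : ℕ)) = vectorInf r (shiftVar 1 x) (a + 1)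
    (-1 + (pairFlip (m + 1) i : ℕ)) (-1 + (j : ℕ))
  have hp := val_pairFlip (m + 1) i
  rcases Nat.even_or_odd (i : ℕ) with hi | hi
  · have he : Even (-1 + ((i : ℕ) + 1 : ℤ)) := by
      rw [neg_add_cancel_comm_assoc]
      exact (Int.even_coe_nat _).mpr hi
    rw [if_pos hi] at hp
    rw [hp, Nat.cast_add, Nat.cast_one, vectorInf_add_one_of_even r x he]
    congr 1 <;> ring
  · have ho : Odd (-1 + (((i : ℕ) - 1 : ℕ) : ℤ)) := by
      have : Even (((i : ℕ) - 1 : ℕ) : ℤ) := (Int.even_coe_nat _).mpr (Nat.Odd.sub_odd hi odd_one)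
      exact ho.add_even this
    rw [if_neg (Nat.not_even_iff_odd.mpr hi)] at hp
    rw [hp, vectorInf_add_one_of_odd r x ho]
    have := hi.pos
    congr 1 <;> omega

theorem window_vectorInf_two (n : ℕ) :
    window (vectorInf r x a) 2 2 n = window (vectorInf r (shiftVar 2 x) a) 0 0 n :=
  window_congr fun p q _ _ => by
    rw [zero_add, zero_add, ← vectorInf_add_two, add_comm (2 : ℤ), add_comm (2 : ℤ)]

/-- Condensation for the blocks of odd size, with the surplus rows and columns of the minors removed.
For `m = 0` the size `2 * m - 1` is `0`: the central minor is then `1`. -/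
theorem det_window_vectorInf_condensation (har : a ≤ (r : ℤ) - 2) (m : ℕ) :
    (window (vectorInf r x a) 0 0 (2 * m + 1)).det *
        (window (vectorInf r (shiftVar 2 x) a) 0 0 (2 * m + 1)).det -
      (window (vectorInf r x a) 0 0 (2 * m + 3)).det *
        (window (vectorInf r (shiftVar 2 x) a) 0 0 (2 * m - 1)).det =
    (-1) ^ (m + 1) * (window (vectorInf r (shiftVar 1 x) (a - 1)) 0 0 (2 * m + 1)).det *
      (window (vectorInf r x a) 0 1 (2 * m + 1 + 1)).det := by
  have h := window_desnanot_jacobi (vectorInf r x a) 0 0 (2 * m + 1)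
  rw [zero_add, det_window_vectorInf_zero, det_window_vectorInf_one r x a har,
    det_window_vectorInf_one_odd r x a har, det_window_vectorInf_one_zero, window_vectorInf_two,
    window_vectorInf_two] at h
  exact h

theorem det_window_vectorInf_a_zero (hx : ∀ l, x 0 l = 1) (hr : 4 ≤ r) (n : ℕ) :
    (window (vectorInf r x 0) 0 0 n).det = 1 := by
  rw [det_of_isUpperTriangular]
  · refine Finset.prod_eq_one fun i _ => ?_
    rcases Int.even_or_odd (0 + ((i : ℕ) : ℤ)) with h | h
    · exact vectorInf_zero_even_self r x hx hr h
    · exact vectorInf_odd_self r x h 0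
  · intro i j hij
    have hij' : (0 : ℤ) + ((j : ℕ) : ℤ) < 0 + ((i : ℕ) : ℤ) := by
      have : (j : ℕ) < (i : ℕ) := hij
      omega
    rcases Int.even_or_odd (0 + ((i : ℕ) : ℤ)) with h | h
    · exact vectorInf_zero_even_of_lt r x hr h hij'
    · exact vectorInf_odd_of_lt r x h 0 hij'

end VectorDeterminants

section SpinorPfaffians

variable (r : ℕ) (x : ℕ → ℤ → ℂ)

theorem window_spinorInf_add_two (s : ℤ) (n : ℕ) :
    window (spinorInf r x) (s + 2) (s + 2) n = window (spinorInf r (shiftVar 2 x)) s s n :=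
  window_congr fun p q _ _ => by
    rw [← spinorInf_add_two, add_right_comm s 2 p, add_right_comm s 2 q]

/-- For the last determinant the complementary minor is a product of two Pfaffians. -/
theorem det_window_vectorInf_last (hr : 4 ≤ r) (n : ℕ) :
    (window (vectorInf r x ((r : ℤ) - 2)) 0 1 (2 * n)).det =
      pf n (window (spinorInf r x) 0 0 (2 * n)) * pf n (window (spinorInf r x) 1 1 (2 * n)) := by
  have h := det_window_eq_pf_mul_pf (spinorInf_skew r x hr) 0 n
  rw [zero_add] at h
  rw [← h]
  congr 1
  refine window_congr fun p q _ _ => ?_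
  rw [vectorInf_sub_two]
  congr 1 <;> ring

/-- The quadratic relation for the node `r - 1`. -/
theorem pf_spinorInf_pred (hr : 4 ≤ r) (n : ℕ) :
    pf (n + 1) (window (spinorInf r x) 0 0 (2 * (n + 1))) *
        pf (n + 1) (window (spinorInf r (shiftVar 2 x)) 0 0 (2 * (n + 1))) -
      pf (n + 2) (window (spinorInf r x) 0 0 (2 * (n + 2))) *
        pf n (window (spinorInf r (shiftVar 2 x)) 0 0 (2 * n)) =
    (window (vectorInf r (shiftVar 2 x) ((r : ℤ) - 2)) 0 0 (2 * n + 1)).det := by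
  have h := pf_window_quadratic (spinorInf_skew r x hr)
    (fun j hj => spinorInf_even_of_gt r x Even.zero (by omega)) n
  have h2 := spinorInf_even_add_two r x Even.zero
  rw [zero_add] at h2
  rw [h2] at h
  simp only [← window_spinorInf_add_two]
  rw [zero_add, h, neg_one_mul, neg_neg]
  congr 1
  refine window_congr fun p q _ _ => ?_
  rw [vectorInf_sub_two, ← spinorInf_add_two]
  congr 1 <;> ring

/-- The quadratic relation for the node `r`: here the last row is the short one, so it follows by
reversing the order of rows and columns. -/
theorem pf_spinorInf_last (hr : 4 ≤ r) (n : ℕ) :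
    pf (n + 1) (window (spinorInf r x) 1 1 (2 * (n + 1))) *
        pf (n + 1) (window (spinorInf r (shiftVar 2 x)) 1 1 (2 * (n + 1))) -
      pf (n + 2) (window (spinorInf r x) 1 1 (2 * (n + 2))) *
        pf n (window (spinorInf r (shiftVar 2 x)) 1 1 (2 * n)) =
    (window (vectorInf r (shiftVar 2 x) ((r : ℤ) - 2)) 0 0 (2 * n + 1)).det := by
  have hev : Even (2 * (n : ℤ) + 4) := ⟨n + 2, by ring⟩
  -- The reversal takes the block from `1` to `2n + 4` to the block from `0` to `2n + 3`.
  let S : Matrix ℤ ℤ ℂ := of fun i j => spinorInf r x (2 * n + 4 - i) (2 * n + 4 - j)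
  have hS : ∀ i j, S i j = -S j i := fun i j => spinorInf_skew r x hr _ _
  have hrev : ∀ (m : ℕ) (s : ℤ), pf m (window S s s (2 * m)) = (-1) ^ m *
      pf m (window (spinorInf r x) (2 * n + 5 - s - 2 * m) (2 * n + 5 - s - 2 * m) (2 * m)) := by
    intro m s
    rw [← pf_rev]
    congr 1
    ext i j
    have hi := i.2
    have hj := j.2
    simp only [window, S, of_apply, submatrix_apply, Fin.val_rev]
    congr 1 <;> omega
  have h := pf_window_quadratic hS (fun j hj => spinorInf_even_of_lt r x (by simpa using hev)
    (by omega)) n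
  have h02 : S 0 2 = 1 := by
    have := spinorInf_even_sub_two r x hev
    simpa [S] using this
  have hdet : (window S 3 1 (2 * n + 1)).det =
      -(window (vectorInf r (shiftVar 2 x) ((r : ℤ) - 2)) 0 0 (2 * n + 1)).det := by
    have h3 : (window S 3 1 (2 * n + 1)) =
        (-(window (vectorInf r (shiftVar 2 x) ((r : ℤ) - 2)) 0 0 (2 * n + 1)))ᵀ.submatrix
          Fin.revPerm Fin.revPerm := by
      ext i j
      have hi := i.2
      have hj := j.2
      simp only [window, S, of_apply, submatrix_apply, Fin.revPerm_apply, Fin.val_rev,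
        transpose_apply, Matrix.neg_apply]
      rw [vectorInf_sub_two, ← spinorInf_add_two, ← spinorInf_skew r x hr]
      congr 1 <;> omega
    rw [h3, det_submatrix_equiv_self, det_transpose, det_neg, Fintype.card_fin, pow_succ, pow_mul]
    simp
  rw [h02, hdet, hrev, hrev, hrev, hrev] at h
  simp only [← window_spinorInf_add_two]
  have e1 : (2 * (n : ℤ) + 5 - 0 - 2 * ((n + 1 : ℕ) : ℤ)) = 1 + 2 := by push_cast; ring
  have e2 : (2 * (n : ℤ) + 5 - 2 - 2 * ((n + 1 : ℕ) : ℤ)) = 1 := by push_cast; ring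
  have e3 : (2 * (n : ℤ) + 5 - 0 - 2 * ((n + 2 : ℕ) : ℤ)) = 1 := by push_cast; ring
  have e4 : (2 * (n : ℤ) + 5 - 2 - 2 * (n : ℤ)) = 1 + 2 := by ring
  rw [e1, e2, e3, e4] at h
  have hs : ((-1 : ℂ) ^ n) * (-1) ^ n = 1 := by
    rw [← mul_pow]
    simp
  rw [pow_succ, pow_succ, pow_succ] at h
  linear_combination h - (pf (n + 1) (window (spinorInf r x) 1 1 (2 * (n + 1))) *
        pf (n + 1) (window (spinorInf r x) (1 + 2) (1 + 2) (2 * (n + 1))) -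
      pf (n + 2) (window (spinorInf r x) 1 1 (2 * (n + 2))) *
        pf n (window (spinorInf r x) (1 + 2) (1 + 2) (2 * n))) * hs

end SpinorPfaffians

/-! ### The Toda equations -/

section Formulas

theorem xvar_add_one (t : ℕ → ℂ → ℂ) (u : ℂ) : xvar t (u + 1) = shiftVar 1 (xvar t u) := by
  funext a l
  simp only [xvar, shiftVar]
  push_cast
  rw [add_assoc, add_comm (1 : ℂ)]

theorem xvar_sub_one (t : ℕ → ℂ → ℂ) (u : ℂ) : xvar t (u - 1) = shiftVar (-1) (xvar t u) := by
  funext a l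
  simp only [xvar, shiftVar]
  push_cast
  rw [show u - 1 + (l : ℂ) = u + (l + -1) by ring]


/-- The determinant formula also holds with the conventions for `k = 0` and `a = 0`. -/
theorem todaT_eq_det {r : ℕ} (hr : 4 ≤ r) (t : ℕ → ℂ → ℂ) (k : ℕ) {a : ℕ} (ha : a ≤ r - 2) (u : ℂ) :
    todaT r t k a u =
      (window (vectorInf r (shiftVar (1 - (k : ℤ)) (xvar t u)) a) 0 0 (2 * k - 1)).det := by
  unfold todaT
  by_cases hk : k = 0
  · subst hk
    rw [if_pos (Or.inl rfl)]
    exact det_fin_zero.symm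
  · by_cases h0 : a = 0
    · subst h0
      rw [if_pos (Or.inr rfl), Nat.cast_zero, det_window_vectorInf_a_zero _ _ _ hr]
      intro l
      simp [shiftVar, xvar]
    · rw [if_neg (by tauto), if_pos ha, vectorMatrix_eq_window]

theorem todaT_pred_eq_pf {r : ℕ} (hr : 4 ≤ r) (t : ℕ → ℂ → ℂ) (k : ℕ) (u : ℂ) :
    todaT r t k (r - 1) u =
      pf k (window (spinorInf r (shiftVar (-(k : ℤ)) (xvar t u))) 0 0 (2 * k)) := by
  unfold todaT
  by_cases hk : k = 0
  · subst hk
    rw [if_pos (Or.inl rfl), pf_zero]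
  · rw [if_neg (by omega), if_neg (by omega), if_pos rfl, pfaffian_eq_pf,
      spinorMatrixPred_eq_window]

theorem todaT_last_eq_pf {r : ℕ} (hr : 4 ≤ r) (t : ℕ → ℂ → ℂ) (k : ℕ) (u : ℂ) :
    todaT r t k r u =
      (-1) ^ k * pf k (window (spinorInf r (shiftVar (-(k : ℤ)) (xvar t u))) 1 1 (2 * k)) := by
  unfold todaT
  by_cases hk : k = 0
  · subst hk
    rw [if_pos (Or.inl rfl), pf_zero, pow_zero, one_mul]
  · rw [if_neg (by omega), if_neg (by omega), if_neg (by omega), pfaffian_eq_pf,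
      spinorMatrixLast_eq_window]

/-- The left-hand side of the Toda equation at the nodes `a ≤ r - 2`, by condensation. -/
theorem todaT_condensation {r : ℕ} (hr : 4 ≤ r) (t : ℕ → ℂ → ℂ) (m : ℕ)
    {a : ℕ} (ha : 1 ≤ a) (har : a ≤ r - 2) (u : ℂ) :
    todaT r t (m + 1) a (u - 1) * todaT r t (m + 1) a (u + 1) -
      todaT r t (m + 2) a u * todaT r t m a u =
    (-1) ^ (m + 1) * todaT r t (m + 1) (a - 1) u *
      (window (vectorInf r (shiftVar (-(m + 1 : ℤ)) (xvar t u)) a) 0 1 (2 * m + 1 + 1)).det := by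
  rw [todaT_eq_det hr t _ har, todaT_eq_det hr t _ har, todaT_eq_det hr t _ har,
    todaT_eq_det hr t _ har, todaT_eq_det hr t _ (by omega), xvar_add_one, xvar_sub_one,
    shiftVar_shiftVar, shiftVar_shiftVar]
  have h := det_window_vectorInf_condensation r (shiftVar (-(m + 1 : ℤ)) (xvar t u)) a (by omega) m
  rw [shiftVar_shiftVar, shiftVar_shiftVar] at h
  have e1 : (1 : ℤ) - ((m + 1 : ℕ) : ℤ) + -1 = -(m + 1) := by push_cast; ring
  have e2 : (1 : ℤ) - ((m + 1 : ℕ) : ℤ) + 1 = 2 + -(m + 1) := by push_cast; ring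
  have e3 : (1 : ℤ) - ((m + 2 : ℕ) : ℤ) = -(m + 1) := by push_cast; ring
  have e4 : (1 : ℤ) - (m : ℤ) = 2 + -(m + 1) := by ring
  have e5 : (1 : ℤ) - ((m + 1 : ℕ) : ℤ) = 1 + -(m + 1) := by push_cast; ring
  have e6 : (((a - 1 : ℕ) : ℕ) : ℤ) = (a : ℤ) - 1 := by omega
  rw [e1, e2, e3, e4, e5, e6]
  exact h

theorem todaT_eq_lt {r : ℕ} (hr : 4 ≤ r) (t : ℕ → ℂ → ℂ) (m : ℕ)
    {a : ℕ} (ha : 1 ≤ a) (har : a ≤ r - 3) (u : ℂ) :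
    todaT r t (m + 1) a (u - 1) * todaT r t (m + 1) a (u + 1) -
      todaT r t (m + 2) a u * todaT r t m a u =
    todaT r t (m + 1) (a - 1) u * todaT r t (m + 1) (a + 1) u := by
  rw [todaT_condensation hr t m ha (by omega), det_window_vectorInf_zero_one _ _ _ (by omega),
    todaT_eq_det hr t _ (show a + 1 ≤ r - 2 by omega), shiftVar_shiftVar]
  have e5 : (1 : ℤ) - ((m + 1 : ℕ) : ℤ) = 1 + -(m + 1) := by push_cast; ring
  have hs : ((-1 : ℂ) ^ (m + 1)) * (-1) ^ (m + 1) = 1 := by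
    rw [← mul_pow]
    simp
  have e7 : 2 * (m + 1) - 1 = 2 * m + 1 := rfl
  rw [e5, e7, Nat.cast_add, Nat.cast_one]
  linear_combination (todaT r t (m + 1) (a - 1) u *
    (window (vectorInf r (shiftVar (1 + -(m + 1 : ℤ)) (xvar t u)) (a + 1)) 0 0
      (2 * m + 1)).det) * hs

theorem todaT_eq_fork {r : ℕ} (hr : 4 ≤ r) (t : ℕ → ℂ → ℂ) (m : ℕ) (u : ℂ) :
    todaT r t (m + 1) (r - 2) (u - 1) * todaT r t (m + 1) (r - 2) (u + 1) -
      todaT r t (m + 2) (r - 2) u * todaT r t m (r - 2) u =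
    todaT r t (m + 1) (r - 3) u * todaT r t (m + 1) (r - 1) u * todaT r t (m + 1) r u := by
  rw [todaT_condensation hr t m (by omega) le_rfl, todaT_pred_eq_pf hr, todaT_last_eq_pf hr]
  have e1 : ((r - 2 : ℕ) : ℤ) = (r : ℤ) - 2 := by omega
  have e2 : r - 2 - 1 = r - 3 := by omega
  have h := det_window_vectorInf_last r (shiftVar (-(m + 1 : ℤ)) (xvar t u)) hr (m + 1)
  rw [e1, e2]
  refine (congrArg₂ (· * ·) rfl h).trans ?_
  push_cast
  ring

theorem todaT_eq_pred {r : ℕ} (hr : 4 ≤ r) (t : ℕ → ℂ → ℂ) (m : ℕ) (u : ℂ) :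
    todaT r t (m + 1) (r - 1) (u - 1) * todaT r t (m + 1) (r - 1) (u + 1) -
      todaT r t (m + 2) (r - 1) u * todaT r t m (r - 1) u = todaT r t (m + 1) (r - 2) u := by
  rw [todaT_pred_eq_pf hr, todaT_pred_eq_pf hr, todaT_pred_eq_pf hr, todaT_pred_eq_pf hr,
    todaT_eq_det hr t _ le_rfl, xvar_add_one, xvar_sub_one, shiftVar_shiftVar, shiftVar_shiftVar]
  have h := pf_spinorInf_pred r (shiftVar (-(m + 2 : ℤ)) (xvar t u)) hr m
  rw [shiftVar_shiftVar] at h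
  have e1 : -((m + 1 : ℕ) : ℤ) + -1 = -(m + 2) := by push_cast; ring
  have e2 : -((m + 1 : ℕ) : ℤ) + 1 = 2 + -(m + 2) := by push_cast; ring
  have e3 : -((m + 2 : ℕ) : ℤ) = -(m + 2) := by push_cast; ring
  have e4 : -(m : ℤ) = 2 + -(m + 2) := by ring
  have e5 : (1 : ℤ) - ((m + 1 : ℕ) : ℤ) = 2 + -(m + 2) := by push_cast; ring
  have e6 : ((r - 2 : ℕ) : ℤ) = (r : ℤ) - 2 := by omega
  rw [e1, e2, e3, e4, e5, e6]
  exact h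

theorem todaT_eq_last {r : ℕ} (hr : 4 ≤ r) (t : ℕ → ℂ → ℂ) (m : ℕ) (u : ℂ) :
    todaT r t (m + 1) r (u - 1) * todaT r t (m + 1) r (u + 1) -
      todaT r t (m + 2) r u * todaT r t m r u = todaT r t (m + 1) (r - 2) u := by
  rw [todaT_last_eq_pf hr, todaT_last_eq_pf hr, todaT_last_eq_pf hr, todaT_last_eq_pf hr,
    todaT_eq_det hr t _ le_rfl, xvar_add_one, xvar_sub_one, shiftVar_shiftVar, shiftVar_shiftVar]
  have h := pf_spinorInf_last r (shiftVar (-(m + 2 : ℤ)) (xvar t u)) hr m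
  rw [shiftVar_shiftVar] at h
  have e1 : -((m + 1 : ℕ) : ℤ) + -1 = -(m + 2) := by push_cast; ring
  have e2 : -((m + 1 : ℕ) : ℤ) + 1 = 2 + -(m + 2) := by push_cast; ring
  have e3 : -((m + 2 : ℕ) : ℤ) = -(m + 2) := by push_cast; ring
  have e4 : -(m : ℤ) = 2 + -(m + 2) := by ring
  have e5 : (1 : ℤ) - ((m + 1 : ℕ) : ℤ) = 2 + -(m + 2) := by push_cast; ring
  have e6 : ((r - 2 : ℕ) : ℤ) = (r : ℤ) - 2 := by omega
  have hs : ((-1 : ℂ) ^ m) * (-1) ^ m = 1 := by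
    rw [← mul_pow]
    simp
  rw [e1, e2, e3, e4, e5, e6]
  refine Eq.trans ?_ h
  rw [pow_succ, pow_succ, pow_succ]
  linear_combination (pf (m + 1) (window (spinorInf r (shiftVar (-(m + 2 : ℤ)) (xvar t u))) 1 1
      (2 * (m + 1))) * pf (m + 1) (window (spinorInf r (shiftVar (2 + -(m + 2 : ℤ)) (xvar t u))) 1 1
      (2 * (m + 1))) - pf (m + 2) (window (spinorInf r (shiftVar (-(m + 2 : ℤ)) (xvar t u))) 1 1
      (2 * (m + 2))) * pf m (window (spinorInf r (shiftVar (2 + -(m + 2 : ℤ)) (xvar t u))) 1 1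
      (2 * m))) * hs

theorem todaT_one {r : ℕ} (hr : 4 ≤ r) (t : ℕ → ℂ → ℂ) {a : ℕ} (ha : 1 ≤ a) (har : a ≤ r) (u : ℂ) :
    todaT r t 1 a u = t a u := by
  have hx : ∀ b, 1 ≤ b → xvar t u b 0 = t b u := by
    intro b hb
    rw [xvar, if_neg (by omega), Int.cast_zero, add_zero]
  rcases Nat.lt_or_ge (r - 2) a with h | h
  · rcases (by omega : a = r - 1 ∨ a = r) with rfl | rfl
    · rw [todaT_pred_eq_pf hr, ← hx (r - 1) (by omega)]
      refine (pf_window_two (spinorInf_skew r _ hr) 0).trans ?_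
      simp [spinorInf, calT_of_even _ _ Even.zero, calE, shiftVar]
    · rw [todaT_last_eq_pf hr, ← hx a (by omega)]
      refine (congrArg₂ (· * ·) rfl (pf_window_two (spinorInf_skew a _ hr) 1)).trans ?_
      rw [spinorInf_skew a _ hr]
      have h2 : (1 : ℤ) + 1 = 2 := rfl
      simp [h2, spinorInf, calT_of_even _ _ even_two, calE, shiftVar]
  · rw [todaT, if_neg (by omega), if_pos h]
    refine (det_fin_one _).trans ?_
    have h1 := subT_apply r (xvar t u) 1 0 0 a 0 ha h
    rw [hx a ha] at h1
    rw [← h1]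
    simp only [vectorMatrix, Matrix.add_apply, subELast, block, of_apply]
    rw [calE_of_odd _ _ (by decide), add_zero]
    simp [subT, block]

end Formulas

theorem theorem1 (r : ℕ) (hr : 4 ≤ r) (t : ℕ → ℂ → ℂ) :
    IsTodaSolution r (todaT r t) ∧
    (∀ a, 1 ≤ a → a ≤ r → ∀ u, todaT r t 1 a u = t a u) ∧
    (∀ k, 1 ≤ k → ∀ u,
      (spinorMatrixPred r (xvar t u) k)ᵀ = -spinorMatrixPred r (xvar t u) k ∧
      (spinorMatrixLast r (xvar t u) k)ᵀ = -spinorMatrixLast r (xvar t u) k) := by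
  refine ⟨⟨fun a _ _ u => by simp [todaT], fun k u => by simp [todaT], ?_, ?_, ?_⟩,
    fun a ha har u => todaT_one hr t ha har u, fun k _ u => ⟨?_, ?_⟩⟩
  · intro k hk a ha har u
    obtain ⟨m, rfl⟩ := Nat.exists_eq_add_of_le' hk
    exact todaT_eq_lt hr t m ha har u
  · intro k hk u
    obtain ⟨m, rfl⟩ := Nat.exists_eq_add_of_le' hk
    exact todaT_eq_fork hr t m u
  · intro k hk a ha u
    obtain ⟨m, rfl⟩ := Nat.exists_eq_add_of_le' hk
    rcases ha with rfl | rfl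
    · exact todaT_eq_pred hr t m u
    · exact todaT_eq_last hr t m u
  · rw [spinorMatrixPred_eq_window]
    ext i j
    exact spinorInf_skew r _ hr _ _
  · rw [spinorMatrixLast_eq_window]
    ext i j
    exact spinorInf_skew r _ hr _ _
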